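/- Let $n\in\mathbb N$, write $\overline B_R=\{x\in\mathbb R^n:|x|\le R\}$, let $\mathcal P_1(\mathbb R^n)$ be the set of Borel probability measures on $\mathbb R^n$ with finite first moment, and let $d_1$ be the Kantorovich–Rubinstein (1-Wasserstein) distance on it. Let $L:\mathbb R^n\times\mathbb R^n\to\mathbb R$ be a reversible strict Tonelli Lagrangian: $L$ is $C^2$, $L(x,v)=L(x,-v)$, and there are constants $C_1,C_2,C_3>0$ such that for all $(x,v)$ $$\tfrac1{C_1}I\le D^2_{vv}L(x,v)\le C_1I,\qquad \|D^2_{vx}L(x,v)\|\le C_2(1+|v|),\qquad |L(x,0)|+|D_xL(x,0)|+|D_vL(x,0)|\le C_3 .$$ Let $H(x,p)=\sup_{v\in\mathbb R^n}\{\langle p,v\rangle-L(x,v)\}$. Let $F:\mathbb R^n\times\mathcal P_1(\mathbb R^n)\to\mathbb R$, let $K_0\subset\mathbb R^n$ be compact, $u^f:\mathbb R^n\to\mathbb R$, and $m_0$ a Borel probability measure on $\mathbb R^n$, such that: * **(F1)** for every $m$, $F(\cdot,m)$ is of class $C^2$ and bounded, with bounded uniformly continuous first and second derivatives, and $\sup_m\sum_{|\alpha|\le2}\|D^\alpha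 F(\cdot,m)\|_\infty<\infty$; * **(F2)** there is a constant $C$ with $|F(x,m_1)-F(x,m_2)|\le C\,d_1(m_1,m_2)$ for all $x,m_1,m_2$; * **(F3)** there is $C_F>0$ such that for all $m_1,m_2\in\mathcal P_1(\mathbb R^n)$ the function $(F(\cdot,m_1)-F(\cdot,m_2))^2$ is Lebesgue integrable and $$\int(F(x,m_1)-F(x,m_2))\,d(m_1-m_2)\ge C_F\int(F(x,m_1)-F(x,m_2))^2\,dx,$$ and the left-hand side is $0$ if and only if $F(x,m_1)=F(x,m_2)$ for all $x\in\mathbb R^n$; * **(F4)** there is $\delta_0>0$ such that for every $m$, $\inf_{x\in\mathbb R^n\setminus K_0}\{L(x,0)+F(x,m)\}-\min_{x\in K_0}\{L(x,0)+F(x,m)\}\ge\delta_0$; * **(F5)** $\bigcap_{m\in\mathcal P_1(\mathbb R^n)}\operatorname{argmin}_{x\in K_0}\{L(x,0)+F(x,m)\}\neq\emptyset$; * **(U)** $u^f$ is $C^1$, globally Lipschitz and bounded below; * **(M)** $m_0$ is absolutely continuous with respect to Lebesgue measure, with compact support contained in $K_0$. For $T>0$, a solution of the mean field game system $$\begin{cases}-\partial_tu+H(x,Du)=F(x,m(t))&\text{in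 }(0,T)\times\mathbb R^n,\\ \partial_tm-\operatorname{div}\big(m\,D_pH(x,Du)\big)=0&\text{in }(0,T)\times\mathbb R^n,\\ m(0)=m_0,\quad u(T,x)=u^f(x)&x\in\mathbb R^n\end{cases}$$ is a pair $(u,m)$ where $u\in W^{1,\infty}_{loc}([0,T]\times\mathbb R^n)$ (that is, $u$ is Lipschitz on $[0,T]\times\overline B_r$ for every $r$), $m:[0,T]\to\mathcal P_1(\mathbb R^n)$ is $d_1$-continuous and has a density in $L^1([0,T]\times\mathbb R^n)$, the first equation holds in the viscosity sense, the second in the sense of distributions, and the initial and terminal conditions hold pointwise. Let $R_0>0$ be such that $K_0\subset\overline B_{R_0}$. Then for every $R\ge R_0$ there is a constant $L_R>0$ (independent of $T$) such that for every $T>1$ and every solution $(u^T,m^T)$ of the system on $[0,T]$, $$|u^T(t,x+h)-u^T(t,x)|\le L_R|h|\qquad\text{for all }t\in[0,T]\text{ and all }x,\,x+h\in\overline B_R .$$ -/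

import Mathlib

open MeasureTheory Set Filter Topology
open scoped ContDiff

noncomputable section

namespace MeanField

/-! All notions are written for a finite-dimensional Euclidean space `E` with its Lebesgue measure;
the case `E = EuclideanSpace ℝ (Fin n)` is that of `ℝⁿ`. -/

variable {E : Type*} [NormedAddCommGroup E] [InnerProductSpace ℝ E] [FiniteDimensional ℝ E]
  [CompleteSpace E] [MeasurableSpace E] [BorelSpace E]

/-- Borel probability measures on `E` with finite first moment. -/
abbrev P1 (E : Type*) [NormedAddCommGroup E] [MeasurableSpace E] : Type _ :=
  {μ : ProbabilityMeasure E // Integrable (fun x : E => ‖x‖) (μ : Measure E)}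

/-- The underlying measure of an element of `P1 E`. -/
def P1.meas (μ : P1 E) : Measure E := (μ.1 : Measure E)

/-- The Kantorovich-Rubinstein (Wasserstein of order one) distance: the infimum of the transport
costs of all couplings. -/
def d1 (μ ν : P1 E) : ℝ :=
  sInf {c : ℝ | ∃ π : Measure (E × E),
    π.map Prod.fst = μ.meas ∧ π.map Prod.snd = ν.meas ∧ c = ∫ z, ‖z.1 - z.2‖ ∂π}

/-- Strict Tonelli Lagrangians. In `vv_bounds` the iterated derivative is the Hessian in `v` as a
bilinear form, in `vx_bound` it is the mixed derivative as a continuous bilinear form. -/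
structure IsStrictTonelli (L : E → E → ℝ) : Prop where
  contDiff : ContDiff ℝ 2 (fun z : E × E => L z.1 z.2)
  vv_bounds : ∃ C₁ > 0, ∀ x v w : E,
    ‖w‖ ^ 2 / C₁ ≤ fderiv ℝ (fun v' => fderiv ℝ (L x) v') v w w ∧
      fderiv ℝ (fun v' => fderiv ℝ (L x) v') v w w ≤ C₁ * ‖w‖ ^ 2
  vx_bound : ∃ C₂ > 0, ∀ x v : E,
    ‖fderiv ℝ (fun x' => fderiv ℝ (L x') v) x‖ ≤ C₂ * (1 + ‖v‖)
  zero_bound : ∃ C₃ > 0, ∀ x : E,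
    |L x 0| + ‖fderiv ℝ (fun x' => L x' 0) x‖ + ‖fderiv ℝ (L x) 0‖ ≤ C₃

/-- Reversibility of a Lagrangian. -/
def IsReversible (L : E → E → ℝ) : Prop := ∀ x v, L x v = L x (-v)

/-- The Hamiltonian associated with `L`. -/
def hamiltonian (L : E → E → ℝ) (x p : E) : ℝ :=
  ⨆ v : E, (inner ℝ p v - L x v)

/-- Each `F(·, m)` is a bounded `C²` function with bounded, uniformly continuous derivatives of
order one and two, and the bounds are uniform in `m`. -/
def CouplingRegular (F : E → P1 E → ℝ) : Prop :=
  (∀ m, ContDiff ℝ 2 (fun x => F x m)) ∧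
  (∀ m, ∀ k : ℕ, 1 ≤ k → k ≤ 2 → UniformContinuous (iteratedFDeriv ℝ k (fun x => F x m))) ∧
  ∃ C : ℝ, ∀ m, ∀ k : ℕ, k ≤ 2 → ∀ x, ‖iteratedFDeriv ℝ k (fun x => F x m) x‖ ≤ C

/-- `F(x, ·)` is Lipschitz for `d1`, uniformly in `x`. -/
def CouplingLipschitz (F : E → P1 E → ℝ) : Prop :=
  ∃ C : ℝ, ∀ x m₁ m₂, |F x m₁ - F x m₂| ≤ C * d1 m₁ m₂

/-- `∫ (F(x, m₁) - F(x, m₂)) d(m₁ - m₂)`. -/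
def couplingGap (F : E → P1 E → ℝ) (m₁ m₂ : P1 E) : ℝ :=
  (∫ x, (F x m₁ - F x m₂) ∂m₁.meas) - ∫ x, (F x m₁ - F x m₂) ∂m₂.meas

/-- Strong monotonicity of the coupling. -/
def CouplingMonotone (F : E → P1 E → ℝ) : Prop :=
  (∃ C > 0, ∀ m₁ m₂,
    Integrable (fun x => (F x m₁ - F x m₂) ^ 2) (volume : Measure E) ∧
    C * ∫ x, (F x m₁ - F x m₂) ^ 2 ≤ couplingGap F m₁ m₂) ∧
  ∀ m₁ m₂, couplingGap F m₁ m₂ = 0 ↔ ∀ x, F x m₁ = F x m₂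

/-- For every `m` the minimum of `L(·,0) + F(·,m)` over the compact set `K` exists and lies below
the infimum over the complement of `K` by at least `δ`, where `δ > 0` does not depend on `m`. -/
def Confining (L : E → E → ℝ) (F : E → P1 E → ℝ) (K : Set E) : Prop :=
  IsCompact K ∧ ∃ δ > 0, ∀ m : P1 E, ∃ x ∈ K,
    (∀ y ∈ K, L x 0 + F x m ≤ L y 0 + F y m) ∧ ∀ y ∉ K, L x 0 + F x m + δ ≤ L y 0 + F y m

/-- The sets of minimizers of `L(·,0) + F(·,m)` over `K` have a common point for all `m`. -/
def CommonMinimizer (L : E → E → ℝ) (F : E → P1 E → ℝ)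
    (K : Set E) : Prop :=
  (⋂ m : P1 E, {x | x ∈ K ∧ IsMinOn (fun y => L y 0 + F y m) K x}).Nonempty

/-- Terminal costs: `C¹`, globally Lipschitz, bounded below. -/
def TerminalCost (uf : E → ℝ) : Prop :=
  ContDiff ℝ 1 uf ∧ (∃ k, LipschitzWith k uf) ∧ ∃ c : ℝ, 0 ≤ c ∧ ∀ x, -c ≤ uf x

/-- Initial distributions: absolutely continuous probability measures with support in `K`. -/
def InitialMeasure (m₀ : Measure E) (K : Set E) : Prop :=
  IsProbabilityMeasure m₀ ∧ m₀ ≪ (volume : Measure E) ∧ IsCompact m₀.support ∧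
    m₀.support ⊆ K

/-- Viscosity solutions of `-∂ₜu + G(t, x, Du) = 0` in `(0,T) × E`. -/
def IsViscositySolution (T : ℝ) (G : ℝ → E → E → ℝ) (u : ℝ → E → ℝ) : Prop :=
  ∀ φ : ℝ × E → ℝ, ContDiffOn ℝ 1 φ (Ioo 0 T ×ˢ univ) →
    ∀ t ∈ Ioo 0 T, ∀ x : E,
      (IsLocalMax (fun z : ℝ × E => u z.1 z.2 - φ z) (t, x) →
        -deriv (fun s => φ (s, x)) t + G t x (gradient (fun y => φ (t, y)) x) ≤ 0) ∧
      (IsLocalMin (fun z : ℝ × E => u z.1 z.2 - φ z) (t, x) →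
        0 ≤ -deriv (fun s => φ (s, x)) t + G t x (gradient (fun y => φ (t, y)) x))

/-- Solutions `(u, m)` on `[0,T]` of the mean field game system
`-∂ₜu + H(x, Du) = F(x, m(t))`, `∂ₜm - div(m D_pH(x, Du)) = 0`, `m(0) = m₀`, `u(T, ·) = uf`,
where `H` is the Hamiltonian of `L`. The values `u t`, `m t` for `t ∉ [0,T]` play no role.

`u ∈ W^{1,∞}_loc([0,T] × E)` is taken in the form of its continuous representative, which is
Lipschitz on `[0,T] × B` for every ball `B`. In particular each `u t` is differentiable almost
everywhere, hence `m t`-almost everywhere for almost every `t`. The function `m` is given by its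
representative that is continuous in time with values in `P1 E`, so that `F(x, m(t))` and the
initial condition are meaningful; it has a density in `L¹([0,T] × E)`. -/
structure IsMFGSolution (L : E → E → ℝ) (F : E → P1 E → ℝ)
    (uf : E → ℝ) (m₀ : Measure E) (T : ℝ) (u : ℝ → E → ℝ) (m : ℝ → P1 E) :
    Prop where
  u_lipschitz : ∀ r : ℝ, ∃ k, LipschitzOnWith k (fun z : ℝ × E => u z.1 z.2)
    (Icc 0 T ×ˢ Metric.closedBall 0 r)
  m_density : ∃ ρ : ℝ × E → ℝ, (∀ z, 0 ≤ ρ z) ∧ IntegrableOn ρ (Icc 0 T ×ˢ univ) ∧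
    ∀ᵐ t ∂(volume.restrict (Icc 0 T)),
      (m t).meas = (volume : Measure E).withDensity (fun x => ENNReal.ofReal (ρ (t, x)))
  m_continuous : ∀ s ∈ Icc 0 T, Tendsto (fun t => d1 (m t) (m s)) (𝓝[Icc 0 T] s) (𝓝 0)
  hamilton_jacobi : IsViscositySolution T (fun t x p => hamiltonian L x p - F x (m t)) u
  continuity_eq : ∀ φ : ℝ × E → ℝ, ContDiff ℝ ∞ φ → HasCompactSupport φ →
    tsupport φ ⊆ Ioo 0 T ×ˢ univ →
    ∫ t in Ioo 0 T, ∫ x, (deriv (fun s => φ (s, x)) t -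
      inner ℝ (gradient (fun y => φ (t, y)) x)
        (gradient (hamiltonian L x) (gradient (u t) x))) ∂(m t).meas = 0
  initial : (m 0).meas = m₀
  terminal : ∀ x, u T x = uf x

end MeanField

end

/-! The measure flow enters only through the running cost. (F4) and (F5) give one point `xb` that
minimizes `L(·,0) + F(·,m)` globally for every `m`. Subtracting from `u` the cost of resting at `xb`
during `[t,T]` (`IsMFGSolution.exists_hjSolution`) alters no spatial difference and leaves a
Hamilton-Jacobi equation in which rest costs nothing at `xb` and a nonnegative amount elsewhere. The
new `u` is thus bounded below by the terminal bound (`HJSolution.lower_bound`). On a ball containing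
`xb` it is bounded above independently of `T`: move to `xb` in unit time and wait
(`HJSolution.upper_bound`).

For the Lipschitz bound, follow a nearly optimal path from `x` for time at most one, and start a
competitor at `x + h` whose displacement from it shrinks from `h` at unit rate. Its extra cost is of
order `|h| ∫ (1 + |w|²)`, where `w` is the velocity of the path. Since `L(x,w) + f ≥ a|w|²`, the
kinetic energy is controlled by the drop of `u` along the path, hence by the two bounds
(`HJSolution.sub_le`).

No minimizers are constructed. The viscosity inequalities are turned into dynamic programming along
segments (`HJSolution.le_add_integral`) and over one short step with error `O(τ²)`
(`HJSolution.exists_step`), and `N` steps are concatenated so that the total error tends to zero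
(`HJSolution.exists_endpoint`). -/

namespace MeanField

/-! ### Convexity, growth and Lipschitz bounds for the Lagrangian -/

section Lagrangian

variable {E : Type*} [NormedAddCommGroup E] [InnerProductSpace ℝ E]

/-- Quantitative consequences of the strict Tonelli condition for a reversible Lagrangian. -/
structure QuadraticLagrangian (L : E → E → ℝ) (a A : ℝ) : Prop where
  pos : 0 < a
  le : a ≤ A
  contDiff : ∀ x, ContDiff ℝ 1 (L x)
  even : ∀ x v, L x (-v) = L x v
  convex : ∀ x v w, L x w + fderiv ℝ (L x) w (v - w) + a * ‖v - w‖ ^ 2 ≤ L x v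
  growth : ∀ x v, L x 0 + a * ‖v‖ ^ 2 ≤ L x v
  upper : ∀ x v, L x v ≤ A * (1 + ‖v‖ ^ 2)
  lipschitz_left : ∀ x y v, |L x v - L y v| ≤ A * (1 + ‖v‖ ^ 2) * ‖x - y‖
  lipschitz_right : ∀ x v h, L x (v - h) ≤ L x v + A * ‖h‖ * (1 + ‖v‖ ^ 2 + ‖h‖)

theorem add_deriv_add_half_le {g g' g'' : ℝ → ℝ} {c : ℝ} (h₁ : ∀ s, HasDerivAt g (g' s) s)
    (h₂ : ∀ s, HasDerivAt g' (g'' s) s) (hc : ∀ s, c ≤ g'' s) : g 0 + g' 0 + c / 2 ≤ g 1 := by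
  have hg' : ∀ s, 0 ≤ s → g' 0 + c * s ≤ g' s := by
    intro s hs
    have hm : Monotone (fun s => g' s - c * s) := by
      apply monotone_of_deriv_nonneg
      · intro s
        exact ((h₂ s).sub ((hasDerivAt_id s).const_mul c)).differentiableAt
      · intro s
        have := ((h₂ s).sub ((hasDerivAt_id s).const_mul c)).deriv
        simp only [id, mul_one] at this
        have h3 : deriv (fun s => g' s - c * s) s = g'' s - c := this
        rw [h3]; linarith [hc s]
    have := hm hs
    simp only [mul_zero, sub_zero] at this
    linarith
  have hd : ∀ s, HasDerivAt (fun s => g s - g' 0 * s - c / 2 * s ^ 2) (g' s - g' 0 - c * s) s := by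
    intro s
    have := ((h₁ s).sub ((hasDerivAt_id s).const_mul (g' 0))).sub
      ((hasDerivAt_pow 2 s).const_mul (c / 2))
    refine this.congr_deriv ?_
    simp; ring
  have hm : MonotoneOn (fun s => g s - g' 0 * s - c / 2 * s ^ 2) (Icc 0 1) := by
    apply monotoneOn_of_deriv_nonneg (convex_Icc 0 1)
    · exact fun s _ => (hd s).continuousAt.continuousWithinAt
    · exact fun s _ => (hd s).differentiableAt.differentiableWithinAt
    · intro s hs
      rw [interior_Icc] at hs
      rw [(hd s).deriv]
      linarith [hg' s hs.1.le]
  have := hm (left_mem_Icc.2 zero_le_one) (right_mem_Icc.2 zero_le_one) zero_le_one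
  simp only [mul_zero, sub_zero, ne_eq, OfNat.ofNat_ne_zero, not_false_eq_true, zero_pow,
    mul_one, one_pow] at this
  linarith

theorem hasDerivAt_comp_segment {f : E → ℝ} (hf : ContDiff ℝ 2 f) (w d : E) (s : ℝ) :
    HasDerivAt (fun s : ℝ => f (w + s • d)) (fderiv ℝ f (w + s • d) d) s ∧
    HasDerivAt (fun s : ℝ => fderiv ℝ f (w + s • d) d)
      (fderiv ℝ (fun v => fderiv ℝ f v) (w + s • d) d d) s := by
  have hl : HasDerivAt (fun s : ℝ => w + s • d) d s := by
    simpa using ((hasDerivAt_id s).smul_const d).const_add w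
  constructor
  · exact ((hf.differentiable (by norm_num)) _).hasFDerivAt.comp_hasDerivAt s hl
  · have h1 : ContDiff ℝ 1 (fderiv ℝ f) := hf.fderiv_right (by norm_num)
    have h2 := ((h1.differentiable (by norm_num)) (w + s • d)).hasFDerivAt.comp_hasDerivAt s hl
    exact (ContinuousLinearMap.apply ℝ ℝ d).hasFDerivAt.comp_hasDerivAt s h2

theorem taylor_lower {f : E → ℝ} (hf : ContDiff ℝ 2 f) {c : ℝ}
    (hc : ∀ v w, c * ‖w‖ ^ 2 ≤ fderiv ℝ (fun v' => fderiv ℝ f v') v w w) (v w : E) :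
    f w + fderiv ℝ f w (v - w) + c / 2 * ‖v - w‖ ^ 2 ≤ f v := by
  have := add_deriv_add_half_le (fun s => (hasDerivAt_comp_segment hf w (v - w) s).1)
    (fun s => (hasDerivAt_comp_segment hf w (v - w) s).2) (fun s => hc _ (v - w))
  simp only [zero_smul, add_zero, one_smul, add_sub_cancel] at this
  linarith

theorem taylor_upper {f : E → ℝ} (hf : ContDiff ℝ 2 f) {c : ℝ}
    (hc : ∀ v w, fderiv ℝ (fun v' => fderiv ℝ f v') v w w ≤ c * ‖w‖ ^ 2) (v w : E) :
    f v ≤ f w + fderiv ℝ f w (v - w) + c / 2 * ‖v - w‖ ^ 2 := by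
  have := add_deriv_add_half_le (fun s => (hasDerivAt_comp_segment hf w (v - w) s).1.neg)
    (fun s => (hasDerivAt_comp_segment hf w (v - w) s).2.neg)
    (fun s => neg_le_neg (hc _ (v - w)))
  simp only [zero_smul, add_zero, one_smul, add_sub_cancel, Pi.neg_apply] at this
  linarith

/-- Everything comes from Taylor's formula in `v`. Reversibility kills the first-order term at `v =
0`: averaging the expansions at `v` and `-v` traps `L(x,v) - L(x,0)` between two multiples of
`|v|²`. -/
theorem IsStrictTonelli.quadraticLagrangian {L : E → E → ℝ} (hL : IsStrictTonelli L)
    (hrev : IsReversible L) : ∃ a A, QuadraticLagrangian L a A := by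
  obtain ⟨C₁, hC₁, h1⟩ := hL.vv_bounds
  obtain ⟨C₂, hC₂, h2⟩ := hL.vx_bound
  obtain ⟨C₃, hC₃, h3⟩ := hL.zero_bound
  have hcv : ∀ x, ContDiff ℝ 2 (L x) := fun x =>
    hL.contDiff.comp (contDiff_const.prodMk contDiff_id : ContDiff ℝ 2 (fun v : E => (x, v)))
  have hcx : ∀ v, ContDiff ℝ 2 (fun x => L x v) := fun v =>
    hL.contDiff.comp (contDiff_id.prodMk contDiff_const : ContDiff ℝ 2 (fun x : E => (x, v)))
  have hL0 : ∀ x, |L x 0| ≤ C₃ := fun x => by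
    linarith [h3 x, norm_nonneg (fderiv ℝ (fun x' => L x' 0) x), norm_nonneg (fderiv ℝ (L x) 0)]
  have hdL0 : ∀ x, ‖fderiv ℝ (fun x' => L x' 0) x‖ ≤ C₃ := fun x => by
    linarith [h3 x, abs_nonneg (L x 0), norm_nonneg (fderiv ℝ (L x) 0)]
  have hlow : ∀ x v w, L x w + fderiv ℝ (L x) w (v - w) + 1 / (2 * C₁) * ‖v - w‖ ^ 2 ≤ L x v := by
    intro x v w
    have := taylor_lower (hcv x) (c := 1 / C₁)
      (fun v w => by have := (h1 x v w).1; rw [div_eq_mul_one_div, mul_comm] at this; exact this) v w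
    have e : 1 / (2 * C₁) = 1 / C₁ / 2 := by field_simp
    rw [e]; exact this
  have hupp : ∀ x v w, L x v ≤ L x w + fderiv ℝ (L x) w (v - w) + C₁ / 2 * ‖v - w‖ ^ 2 :=
    fun x v w => taylor_upper (hcv x) (fun v w => (h1 x v w).2) v w
  have hgrow : ∀ x v, L x 0 + 1 / (2 * C₁) * ‖v‖ ^ 2 ≤ L x v := by
    intro x v
    have e1 := hlow x v 0
    have e2 := hlow x (-v) 0
    rw [← hrev x v] at e2
    simp only [sub_zero, map_neg, norm_neg] at e1 e2
    linarith
  have hupp0 : ∀ x v, L x v ≤ L x 0 + C₁ / 2 * ‖v‖ ^ 2 := by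
    intro x v
    have e1 := hupp x v 0
    have e2 := hupp x (-v) 0
    rw [← hrev x v] at e2
    simp only [sub_zero, map_neg, norm_neg] at e1 e2
    linarith
  have hDx : ∀ v x y, ‖fderiv ℝ (L x) v - fderiv ℝ (L y) v‖ ≤ C₂ * (1 + ‖v‖) * ‖x - y‖ := by
    intro v x y
    have hd : Differentiable ℝ (fun x' => fderiv ℝ (L x') v) := by
      have : ContDiff ℝ 1 (fun x' => fderiv ℝ (L x') v) :=
        ContDiff.fderiv (f := L) hL.contDiff contDiff_const (by norm_num)
      exact this.differentiable (by norm_num)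
    exact convex_univ.norm_image_sub_le_of_norm_fderiv_le (𝕜 := ℝ)
      (fun z _ => hd z) (fun z _ => h2 z v) (mem_univ y) (mem_univ x)
  have hlx : ∀ x y v, |L x v - L y v| ≤ (2 * C₂ + C₃) * (1 + ‖v‖ ^ 2) * ‖x - y‖ := by
    intro x y v
    have e0 : |L x 0 - L y 0| ≤ C₃ * ‖x - y‖ := by
      have := convex_univ.norm_image_sub_le_of_norm_fderiv_le (𝕜 := ℝ) (f := fun x' => L x' 0)
        (fun z _ => (hcx 0).differentiable (by norm_num) z) (fun z _ => hdL0 z)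
        (mem_univ y) (mem_univ x)
      simpa using this
    have e1 : |(L x v - L y v) - (L x 0 - L y 0)| ≤ C₂ * (1 + ‖v‖) * ‖x - y‖ * ‖v‖ := by
      have := (convex_Icc (0 : ℝ) 1).norm_image_sub_le_of_norm_hasDerivWithin_le
        (f := fun s : ℝ => L x (0 + s • v) - L y (0 + s • v))
        (f' := fun s => fderiv ℝ (L x) (0 + s • v) v - fderiv ℝ (L y) (0 + s • v) v)
        (C := C₂ * (1 + ‖v‖) * ‖x - y‖ * ‖v‖)
        (fun s _ => ((hasDerivAt_comp_segment (hcv x) 0 v s).1.sub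
          (hasDerivAt_comp_segment (hcv y) 0 v s).1).hasDerivWithinAt)
        (fun s hs => by
          rw [← sub_apply]
          refine (ContinuousLinearMap.le_opNorm _ _).trans ?_
          gcongr
          refine (hDx _ x y).trans ?_
          have : ‖(0 : E) + s • v‖ ≤ ‖v‖ := by
            rw [zero_add, norm_smul, Real.norm_of_nonneg hs.1]
            exact mul_le_of_le_one_left (norm_nonneg v) hs.2
          gcongr)
        (left_mem_Icc.2 zero_le_one) (right_mem_Icc.2 zero_le_one)
      simpa using this
    have e2 : |L x v - L y v| ≤ C₂ * (1 + ‖v‖) * ‖x - y‖ * ‖v‖ + C₃ * ‖x - y‖ := by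
      have := abs_add_le ((L x v - L y v) - (L x 0 - L y 0)) (L x 0 - L y 0)
      rw [sub_add_cancel] at this
      linarith
    refine e2.trans ?_
    have hv := norm_nonneg v
    have hxy := norm_nonneg (x - y)
    have e3 : C₂ * ((1 + ‖v‖) * ‖v‖) + C₃ ≤ (2 * C₂ + C₃) * (1 + ‖v‖ ^ 2) := by
      nlinarith [sq_nonneg (‖v‖ - 1), mul_nonneg hC₃.le (sq_nonneg ‖v‖),
        mul_nonneg hC₂.le (sq_nonneg (‖v‖ - 1)), mul_nonneg hC₂.le (sq_nonneg (‖v‖))]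
    calc _ = (C₂ * ((1 + ‖v‖) * ‖v‖) + C₃) * ‖x - y‖ := by ring
      _ ≤ _ := by gcongr
  have hlv : ∀ x v h, L x (v - h) ≤ L x v + (2 * C₃ + 2 * C₁) * ‖h‖ * (1 + ‖v‖ ^ 2 + ‖h‖) := by
    intro x v h
    rcases eq_or_ne h 0 with rfl | hh
    · simp
    have hp : 0 < ‖h‖ := norm_pos_iff.2 hh
    have e1 := hupp x (v - h) v
    -- Convexity bounds the slope at `v` in the direction `-h` by the increment of `L` over a unit
    -- step, which the quadratic bounds control.
    have e2 := hlow x (v - ‖h‖⁻¹ • h) v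
    have e3 := hupp0 x (v - ‖h‖⁻¹ • h)
    have e4 := hgrow x v
    have hn : ‖v - ‖h‖⁻¹ • h‖ ≤ ‖v‖ + 1 := by
      refine (norm_sub_le _ _).trans ?_
      rw [norm_smul, norm_inv, norm_norm, inv_mul_cancel₀ hp.ne']
    have hn2 : ‖v - ‖h‖⁻¹ • h‖ ^ 2 ≤ 2 * ‖v‖ ^ 2 + 2 := by
      nlinarith [norm_nonneg (v - ‖h‖⁻¹ • h), sq_nonneg (‖v‖ - 1)]
    simp only [sub_sub_cancel_left, map_neg, map_smul, smul_eq_mul, norm_neg] at e1 e2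
    have hpos : 0 ≤ 1 / (2 * C₁) := by positivity
    have e5 : -(‖h‖⁻¹ * fderiv ℝ (L x) v h) ≤ C₁ * (‖v‖ ^ 2 + 1) := by
      nlinarith [mul_nonneg hpos (sq_nonneg ‖v‖), mul_nonneg hpos (sq_nonneg ‖‖h‖⁻¹ • h‖),
        mul_le_mul_of_nonneg_left hn2 hC₁.le]
    have e6 : -(fderiv ℝ (L x) v h) ≤ ‖h‖ * (C₁ * (‖v‖ ^ 2 + 1)) := by
      have := mul_le_mul_of_nonneg_left e5 hp.le
      rwa [mul_neg, mul_inv_cancel_left₀ hp.ne'] at this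
    have e7 : (0:ℝ) ≤ C₃ * ‖h‖ * (1 + ‖v‖ ^ 2 + ‖h‖) := by positivity
    have e8 : (0:ℝ) ≤ C₁ * ‖h‖ * (1 + ‖v‖ ^ 2 + ‖h‖) := by positivity
    nlinarith [mul_nonneg hC₁.le (sq_nonneg ‖h‖)]
  set a := 1 / (2 * C₁)
  have ha : 0 < a := by positivity
  set A := a + C₁ / 2 + C₃ + (2 * C₂ + C₃) + (2 * C₃ + 2 * C₁)
  refine ⟨a, A, ha, ?_, fun x => (hcv x).of_le (by norm_num), fun x v => (hrev x v).symm, hlow,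
    hgrow, fun x v => ?_, fun x y v => (hlx x y v).trans ?_, fun x v h => (hlv x v h).trans ?_⟩
  · simp only [A]; linarith
  · have := hupp0 x v
    have h0 := le_abs_self (L x 0)
    have h4 := hL0 x
    have hAa : C₁ / 2 ≤ A := by simp only [A]; linarith
    have hAb : C₃ ≤ A := by simp only [A]; linarith
    nlinarith [mul_le_mul_of_nonneg_right hAa (sq_nonneg ‖v‖)]
  · gcongr; simp only [A]; linarith
  · gcongr; simp only [A]; linarith

end Lagrangian

/-! ### Viscosity inequalities along directions, and penalized minima -/

section Viscosity

/-- The test functions used below contain barriers `κ / (s - s₀)`, which are singular inside the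
strip. A bump function makes them globally `C¹` without changing their germ. -/
theorem exists_contDiff_eventuallyEq {X : Type*} [NormedAddCommGroup X] [NormedSpace ℝ X]
    [FiniteDimensional ℝ X] {φ : X → ℝ} {z : X} (hφ : ContDiffAt ℝ 1 φ z) :
    ∃ ψ : X → ℝ, ContDiff ℝ 1 ψ ∧ ψ =ᶠ[𝓝 z] φ := by
  obtain ⟨s, hs, hφs⟩ := hφ.contDiffOn (m := 1) le_rfl (by simp)
  have hs' : s ∈ 𝓝 z := by simpa using hs
  obtain ⟨r, hr, hrs⟩ := Metric.mem_nhds_iff.1 hs'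
  let b : ContDiffBump z := ⟨r / 4, r / 2, by positivity, by linarith⟩
  refine ⟨fun y => b y * φ y, ?_, ?_⟩
  · rw [contDiff_iff_contDiffAt]
    intro y
    by_cases hy : y ∈ Metric.ball z r
    · exact b.contDiff.contDiffAt.mul
        ((hφs.mono hrs).contDiffAt (Metric.isOpen_ball.mem_nhds hy))
    · have hy' : y ∉ tsupport b := by
        rw [b.tsupport_eq]
        intro h
        apply hy
        have h1 : dist y z ≤ r / 2 := h
        exact Metric.mem_ball.2 (by linarith)
      have : (fun y => b y * φ y) =ᶠ[𝓝 y] fun _ => 0 := by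
        filter_upwards [(isClosed_tsupport b).isOpen_compl.mem_nhds hy'] with w hw
        rw [image_eq_zero_of_notMem_tsupport hw, zero_mul]
      exact contDiffAt_const.congr_of_eventuallyEq this
  · filter_upwards [b.eventuallyEq_one] with y hy
    simp [hy]

variable {E : Type*} [NormedAddCommGroup E] [InnerProductSpace ℝ E]

/-- Subsolution inequality in terms of directional derivatives of local `C¹` test functions. -/
def SubTest (L : E → E → ℝ) (f : ℝ → E → ℝ) (T : ℝ) (u : ℝ → E → ℝ) : Prop :=
  ∀ t ∈ Ioo 0 T, ∀ x : E, ∀ φ : ℝ × E → ℝ, ContDiffAt ℝ 1 φ (t, x) →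
    IsLocalMax (fun z : ℝ × E => u z.1 z.2 - φ z) (t, x) →
    ∀ v, 0 ≤ fderiv ℝ φ (t, x) (1, v) + L x v + f t x

/-- Supersolution inequality in terms of directional derivatives of local `C¹` test functions. -/
def SuperTest (L : E → E → ℝ) (f : ℝ → E → ℝ) (T : ℝ) (u : ℝ → E → ℝ) : Prop :=
  ∀ t ∈ Ioo 0 T, ∀ x : E, ∀ φ : ℝ × E → ℝ, ContDiffAt ℝ 1 φ (t, x) →
    IsLocalMin (fun z : ℝ × E => u z.1 z.2 - φ z) (t, x) →
    ∀ ε > 0, ∃ v, fderiv ℝ φ (t, x) (1, v) + L x v + f t x < ε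

theorem QuadraticLagrangian.bddAbove_range {L : E → E → ℝ} {a A : ℝ}
    (hL : QuadraticLagrangian L a A) (x p : E) :
    BddAbove (range fun v : E => inner ℝ p v - L x v) := by
  refine ⟨‖p‖ ^ 2 / (4 * a) - L x 0, ?_⟩
  rintro _ ⟨v, rfl⟩
  have h1 := hL.growth x v
  have h2 := real_inner_le_norm p v
  have h3 : ‖p‖ * ‖v‖ ≤ ‖p‖ ^ 2 / (4 * a) + a * ‖v‖ ^ 2 := by
    have ha := hL.pos
    have : ‖p‖ ^ 2 / (4 * a) + a * ‖v‖ ^ 2 - ‖p‖ * ‖v‖ = (‖p‖ - 2 * a * ‖v‖) ^ 2 / (4 * a) := by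
      field_simp; ring
    have h0 : 0 ≤ (‖p‖ - 2 * a * ‖v‖) ^ 2 / (4 * a) := by positivity
    linarith
  simp only
  linarith

theorem deriv_slice {φ : ℝ × E → ℝ} {t : ℝ} {x : E} (hφ : DifferentiableAt ℝ φ (t, x)) :
    deriv (fun s => φ (s, x)) t = fderiv ℝ φ (t, x) (1, 0) := by
  have h1 : HasFDerivAt (fun s => φ (s, x))
      ((fderiv ℝ φ (t, x)).comp (ContinuousLinearMap.inl ℝ ℝ E)) t :=
    hφ.hasFDerivAt.comp t (hasFDerivAt_prodMk_left t x)
  rw [h1.hasDerivAt.deriv]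
  rfl

theorem fderiv_one_pair {φ : ℝ × E → ℝ} {z : ℝ × E} (v : E) :
    fderiv ℝ φ z (1, v) = fderiv ℝ φ z (1, 0) + fderiv ℝ φ z (0, v) := by
  rw [← map_add]; simp

theorem fderiv_add_time {φ : ℝ × E → ℝ} {b : ℝ → ℝ} {b' t : ℝ} {x : E}
    (hφ : DifferentiableAt ℝ φ (t, x)) (hb : HasDerivAt b b' t) (v : E) :
    fderiv ℝ (fun z : ℝ × E => φ z + b z.1) (t, x) (1, v) = fderiv ℝ φ (t, x) (1, v) + b' := by
  have h2 : HasFDerivAt (fun z : ℝ × E => b z.1)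
      ((ContinuousLinearMap.toSpanSingleton ℝ b').comp (ContinuousLinearMap.fst ℝ ℝ E)) (t, x) :=
    hb.hasFDerivAt.comp (t, x) hasFDerivAt_fst
  have h3 : HasFDerivAt (fun z : ℝ × E => φ z + b z.1) _ (t, x) := hφ.hasFDerivAt.add h2
  rw [h3.fderiv]
  simp

theorem SubTest.sub_time {L : E → E → ℝ} {f : ℝ → E → ℝ} {T : ℝ} {u : ℝ → E → ℝ}
    (h : SubTest L f T u) {b l : ℝ → ℝ} (hb : ContDiff ℝ 1 b)
    (hb' : ∀ t, HasDerivAt b (-l t) t) :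
    SubTest L (fun t x => f t x - l t) T (fun t x => u t x - b t) := by
  intro t ht x φ hφ hmax v
  have := h t ht x (fun z => φ z + b z.1)
    (hφ.add (hb.contDiffAt.comp (t, x) contDiffAt_fst)) ?_ v
  · rw [fderiv_add_time (hφ.differentiableAt (by norm_num)) (hb' t)] at this
    linarith
  · convert hmax using 2 with z
    ring

theorem SuperTest.sub_time {L : E → E → ℝ} {f : ℝ → E → ℝ} {T : ℝ} {u : ℝ → E → ℝ}
    (h : SuperTest L f T u) {b l : ℝ → ℝ} (hb : ContDiff ℝ 1 b)
    (hb' : ∀ t, HasDerivAt b (-l t) t) :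
    SuperTest L (fun t x => f t x - l t) T (fun t x => u t x - b t) := by
  intro t ht x φ hφ hmin ε hε
  obtain ⟨v, hv⟩ := h t ht x (fun z => φ z + b z.1)
    (hφ.add (hb.contDiffAt.comp (t, x) contDiffAt_fst))
    (by convert hmin using 2 with z; ring) ε hε
  rw [fderiv_add_time (hφ.differentiableAt (by norm_num)) (hb' t)] at hv
  exact ⟨v, by linarith⟩

section

variable [CompleteSpace E]

theorem inner_gradient_slice {φ : ℝ × E → ℝ} {t : ℝ} {x : E}
    (hφ : DifferentiableAt ℝ φ (t, x)) (v : E) :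
    inner ℝ (gradient (fun y => φ (t, y)) x) v = fderiv ℝ φ (t, x) (0, v) := by
  have h1 : HasFDerivAt (fun y => φ (t, y))
      ((fderiv ℝ φ (t, x)).comp (ContinuousLinearMap.inr ℝ ℝ E)) x :=
    hφ.hasFDerivAt.comp x (hasFDerivAt_prodMk_right t x)
  rw [gradient, InnerProductSpace.toDual_symm_apply, h1.fderiv]
  rfl

end

variable [FiniteDimensional ℝ E] [CompleteSpace E]

/-- Each `-v` competes in the supremum defining the Hamiltonian, and `L` is even. -/
theorem IsViscositySolution.subTest {L : E → E → ℝ} {a A T : ℝ} {f : ℝ → E → ℝ} {u : ℝ → E → ℝ}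
    (hL : QuadraticLagrangian L a A)
    (hu : IsViscositySolution T (fun t x p => hamiltonian L x p - f t x) u) :
    SubTest L f T u := by
  intro t ht x φ hφ hmax v
  obtain ⟨ψ, hψ, heq⟩ := exists_contDiff_eventuallyEq hφ
  have hmax' : IsLocalMax (fun z : ℝ × E => u z.1 z.2 - ψ z) (t, x) := by
    refine hmax.congr ?_
    filter_upwards [heq] with z hz
    rw [hz]
  have hψd : DifferentiableAt ℝ ψ (t, x) := hψ.differentiable (by norm_num) _
  have := (hu ψ hψ.contDiffOn t ht x).1 hmax'
  simp only [deriv_slice hψd] at this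
  have h2 : inner ℝ (gradient (fun y => ψ (t, y)) x) (-v) - L x (-v) ≤
      hamiltonian L x (gradient (fun y => ψ (t, y)) x) :=
    le_ciSup (hL.bddAbove_range x _) (-v)
  rw [inner_gradient_slice hψd, hL.even, ← neg_zero, ← Prod.neg_mk, map_neg] at h2
  rw [← heq.fderiv_eq, fderiv_one_pair]
  linarith

/-- Were every direction off by `ε`, the supremum would be too small by `ε`. Allowing `ε` avoids
having to attain the supremum. -/
theorem IsViscositySolution.superTest {L : E → E → ℝ} {a A T : ℝ} {f : ℝ → E → ℝ}
    {u : ℝ → E → ℝ} (hL : QuadraticLagrangian L a A)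
    (hu : IsViscositySolution T (fun t x p => hamiltonian L x p - f t x) u) :
    SuperTest L f T u := by
  intro t ht x φ hφ hmin ε hε
  obtain ⟨ψ, hψ, heq⟩ := exists_contDiff_eventuallyEq hφ
  have hmin' : IsLocalMin (fun z : ℝ × E => u z.1 z.2 - ψ z) (t, x) := by
    refine hmin.congr ?_
    filter_upwards [heq] with z hz
    rw [hz]
  have hψd : DifferentiableAt ℝ ψ (t, x) := hψ.differentiable (by norm_num) _
  have := (hu ψ hψ.contDiffOn t ht x).2 hmin'
  simp only [deriv_slice hψd] at this
  by_contra! hcon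
  have h2 : hamiltonian L x (gradient (fun y => ψ (t, y)) x) ≤
      fderiv ℝ ψ (t, x) (1, 0) + f t x - ε := by
    refine ciSup_le fun v => ?_
    have h3 := hcon (-v)
    have h4 : ((0 : ℝ), -v) = -((0 : ℝ), v) := by simp
    rw [← heq.fderiv_eq, fderiv_one_pair, hL.even, h4, map_neg] at h3
    rw [inner_gradient_slice hψd]
    linarith
  linarith

/-- The barrier repels minima from the initial time, where `Ψ` need not be defined sensibly. The gap
`γ` repels them from the final time, so a minimum sits at an interior time, where a viscosity test
applies. -/
theorem exists_penalized_min {X : Type*} [TopologicalSpace X] {K : Set X} (hK : IsCompact K)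
    {s₀ s₁ : ℝ} {Ψ : ℝ × X → ℝ} (hc : ContinuousOn Ψ (Ioc s₀ s₁ ×ˢ K)) {M : ℝ}
    (hM : ∀ z ∈ Ioc s₀ s₁ ×ˢ K, M ≤ Ψ z) {c : ℝ}
    (h₀ : ∀ δ > 0, ∃ z ∈ Ioo s₀ s₁ ×ˢ K, Ψ z < c + δ) {γ : ℝ} (hγ : 0 < γ)
    (h₁ : ∀ y ∈ K, c + γ ≤ Ψ (s₁, y)) :
    ∃ κ > 0, ∃ z ∈ Ioo s₀ s₁ ×ˢ K, ∀ z' ∈ Ioc s₀ s₁ ×ˢ K,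
      Ψ z + κ / (z.1 - s₀) ≤ Ψ z' + κ / (z'.1 - s₀) := by
  obtain ⟨⟨s, y⟩, ⟨⟨hs0, hs1⟩, hy⟩, hlt⟩ := h₀ (γ / 2) (by positivity)
  simp only at hs0 hs1 hy
  -- At the almost optimal point `(s, y)` the barrier then costs exactly `γ / 4`.
  set κ := γ / 4 * (s - s₀) with hκ
  have hκpos : 0 < κ := mul_pos (by positivity) (sub_pos.2 hs0)
  have hval : Ψ (s, y) + κ / (s - s₀) < c + 3 / 4 * γ := by
    rw [hκ, mul_div_assoc, div_self (sub_pos.2 hs0).ne']; linarith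
  -- Before time `s₀ + σ` the barrier alone beats the lower bound `M`, so minimizing over a compact
  -- time interval suffices.
  set σ := min (s - s₀) (κ / (|c| + γ + |M|)) with hσ
  have hden : 0 < |c| + γ + |M| := by positivity
  have hσpos : 0 < σ := lt_min (sub_pos.2 hs0) (by positivity)
  have hσs : σ ≤ s - s₀ := min_le_left _ _
  have hsub : Icc (s₀ + σ) s₁ ×ˢ K ⊆ Ioc s₀ s₁ ×ˢ K :=
    prod_mono (fun r hr => ⟨by linarith [hr.1], hr.2⟩) subset_rfl
  obtain ⟨z, hz, hzmin⟩ := (isCompact_Icc.prod hK).exists_isMinOn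
    (⟨(s, y), ⟨by linarith, hs1.le⟩, hy⟩ : (Icc (s₀ + σ) s₁ ×ˢ K).Nonempty)
    (f := fun z => Ψ z + κ / (z.1 - s₀))
    ((hc.mono hsub).add (continuousOn_const.div (continuousOn_fst.sub continuousOn_const)
      (fun z hz => by have := hz.1.1; intro h; linarith)))
  have hzle : Ψ z + κ / (z.1 - s₀) < c + 3 / 4 * γ :=
    (hzmin (⟨⟨by linarith, hs1.le⟩, hy⟩ : (s, y) ∈ Icc (s₀ + σ) s₁ ×ˢ K)).trans_lt hval
  have hz0 : s₀ < z.1 := (hsub hz).1.1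
  refine ⟨κ, hκpos, z, ⟨⟨hz0, lt_of_le_of_ne hz.1.2 ?_⟩, hz.2⟩, fun z' hz' => ?_⟩
  · intro h
    have h2 := h₁ z.2 hz.2
    rw [← h] at h2
    have : 0 < κ / (z.1 - s₀) := div_pos hκpos (sub_pos.2 hz0)
    linarith
  · rcases le_or_gt (s₀ + σ) z'.1 with h | h
    · exact hzmin (⟨⟨h, hz'.1.2⟩, hz'.2⟩ : z' ∈ Icc (s₀ + σ) s₁ ×ˢ K)
    · have h2 := hM z' hz'
      have h3 : |c| + γ + |M| ≤ κ / (z'.1 - s₀) := by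
        rw [le_div_iff₀ (sub_pos.2 hz'.1.1)]
        have : z'.1 - s₀ ≤ κ / (|c| + γ + |M|) := by
          have := min_le_right (s - s₀) (κ / (|c| + γ + |M|)); linarith
        rw [le_div_iff₀ hden] at this
        linarith
      have := neg_abs_le M
      have := le_abs_self c
      linarith

end Viscosity

/-! ### Dynamic programming from viscosity tests -/

section DynamicProgramming

theorem eventually_mul_lt (C : ℝ) {δ : ℝ} (hδ : 0 < δ) : ∀ᶠ ε in 𝓝[>] (0 : ℝ), C * ε < δ := by
  have : Tendsto (fun ε : ℝ => C * ε) (𝓝[>] 0) (𝓝 (C * 0)) :=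
    ((continuous_const.mul continuous_id).tendsto 0).mono_left nhdsWithin_le_nhds
  rw [mul_zero] at this
  exact this.eventually_lt_const hδ

theorem hasDerivAt_integral_right {g : ℝ → ℝ} (hg : Continuous g) (c s : ℝ) :
    HasDerivAt (fun s => ∫ r in c..s, g r) (g s) s :=
  intervalIntegral.integral_hasDerivAt_right (hg.intervalIntegrable c s)
    (hg.stronglyMeasurableAtFilter _ _) hg.continuousAt

theorem contDiff_integral_right {g : ℝ → ℝ} (hg : Continuous g) (c : ℝ) :
    ContDiff ℝ 1 (fun s => ∫ r in c..s, g r) := by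
  rw [contDiff_one_iff_deriv]
  refine ⟨fun s => (hasDerivAt_integral_right hg c s).differentiableAt, ?_⟩
  have : deriv (fun s => ∫ r in c..s, g r) = g :=
    funext fun s => (hasDerivAt_integral_right hg c s).deriv
  rwa [this]

theorem abs_sub_le_of_lipschitzOnWith {E : Type*} [NormedAddCommGroup E]
    {u : ℝ → E → ℝ} {T r : ℝ} {k : NNReal}
    (hk : LipschitzOnWith k (fun z : ℝ × E => u z.1 z.2) (Icc 0 T ×ˢ Metric.closedBall 0 r))
    {s : ℝ} (hs : s ∈ Icc 0 T) {x y : E} (hx : ‖x‖ ≤ r) (hy : ‖y‖ ≤ r) :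
    |u s x - u s y| ≤ k * ‖x - y‖ := by
  have := hk.dist_le_mul (s, x) ⟨hs, by simpa using hx⟩ (s, y) ⟨hs, by simpa using hy⟩
  rw [Prod.dist_eq] at this
  simpa [Real.dist_eq, dist_eq_norm] using this

variable {E : Type*} [NormedAddCommGroup E] [InnerProductSpace ℝ E]

theorem fderiv_eq_of_hasDerivAt_line {φ : ℝ × E → ℝ} {t d : ℝ} {x v : E}
    (hφ : DifferentiableAt ℝ φ (t, x))
    (hd : HasDerivAt (fun r : ℝ => φ (t + r, x + r • v)) d 0) :
    fderiv ℝ φ (t, x) (1, v) = d := by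
  have hl : HasDerivAt (fun r : ℝ => (t + r, x + r • v)) ((1 : ℝ), v) 0 := by
    refine HasDerivAt.prodMk ((hasDerivAt_id (0 : ℝ)).const_add t) ?_
    simpa using ((hasDerivAt_id (0 : ℝ)).smul_const v).const_add x
  have h1 : HasFDerivAt φ (fderiv ℝ φ (t, x)) ((fun r : ℝ => (t + r, x + r • v)) 0) := by
    simpa using hφ.hasFDerivAt
  exact (h1.comp_hasDerivAt (0 : ℝ) hl).unique hd

/-- Locally Lipschitz solutions of `-∂ₜu + H(x, Du) = f(t, x)`, where `f` is bounded, Lipschitz in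
space and such that staying at rest has nonnegative cost. -/
structure HJSolution (L : E → E → ℝ) (f : ℝ → E → ℝ) (T : ℝ) (u : ℝ → E → ℝ) (A : ℝ) : Prop where
  continuous_time : ∀ x, Continuous (fun t => f t x)
  lipschitz_space : ∀ t x y, |f t x - f t y| ≤ A * ‖x - y‖
  bounded : ∀ t x, |f t x| ≤ A
  nonneg : ∀ t x, 0 ≤ L x 0 + f t x
  u_lipschitz : ∀ r : ℝ, ∃ k, LipschitzOnWith k (fun z : ℝ × E => u z.1 z.2)
    (Icc 0 T ×ˢ Metric.closedBall 0 r)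
  sub : SubTest L f T u
  super : SuperTest L f T u

variable {L : E → E → ℝ} {f : ℝ → E → ℝ} {T a A : ℝ} {u : ℝ → E → ℝ}

variable [FiniteDimensional ℝ E]

/-- The dynamic programming inequality along a segment. -/
theorem HJSolution.le_add_integral (hL : QuadraticLagrangian L a A) (hu : HJSolution L f T u A)
    {t₀ t₁ : ℝ} (h0 : 0 ≤ t₀) (h01 : t₀ < t₁) (h1 : t₁ ≤ T) (x₀ v : E) {g : ℝ → ℝ}
    (hg : Continuous g)
    (hfg : ∀ r ∈ Icc t₀ t₁, L (x₀ + (r - t₀) • v) v + f r (x₀ + (r - t₀) • v) ≤ g r) :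
    u t₀ x₀ ≤ u t₁ (x₀ + (t₁ - t₀) • v) + ∫ r in t₀..t₁, g r := by
  by_contra! hcon
  set X : ℝ → E := fun s => x₀ + (s - t₀) • v with hX
  have hXc : Continuous X := by fun_prop
  have hXd : ContDiff ℝ 1 X := by fun_prop
  set D := u t₀ x₀ - (u t₁ (X t₁) + ∫ r in t₀..t₁, g r) with hD
  have hDpos : 0 < D := sub_pos.2 hcon
  set ρ := ‖x₀‖ + (t₁ - t₀) * ‖v‖ + 1 with hρ
  have hXρ : ∀ s ∈ Icc t₀ t₁, ‖X s‖ ≤ ρ - 1 := by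
    intro s hs
    refine (norm_add_le _ _).trans ?_
    rw [norm_smul, Real.norm_of_nonneg (sub_nonneg.2 hs.1)]
    have : (s - t₀) * ‖v‖ ≤ (t₁ - t₀) * ‖v‖ := by gcongr; exact hs.2
    linarith
  obtain ⟨k, hk⟩ := hu.u_lipschitz ρ
  have hA : 0 < A := hL.pos.trans_le hL.le
  set Cv := A * (1 + ‖v‖ ^ 2) + A with hCv
  have hCvpos : 0 < Cv := by positivity
  -- The gap `D` is split in three: one third pays for the slope `η` that makes the test strict, one
  -- for the spatial penalty, and one remains as the gap at time `t₁`.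
  set η := D / (3 * (t₁ - t₀)) with hη
  have ht : 0 < t₁ - t₀ := sub_pos.2 h01
  have hηpos : 0 < η := by positivity
  obtain ⟨ε, ⟨⟨hε1, hε2⟩, hε3⟩, hε⟩ := ((((eventually_mul_lt (k : ℝ) one_pos).and
    (eventually_mul_lt ((k : ℝ) ^ 2) (by positivity : 0 < D / 3))).and
    (eventually_mul_lt (Cv * k) hηpos)).and self_mem_nhdsWithin).exists
  have hεpos : (0 : ℝ) < ε := hε
  have hIcc : ∀ s ∈ Icc t₀ t₁, s ∈ Icc 0 T := fun s hs => ⟨h0.trans hs.1, hs.2.trans h1⟩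
  have hquad : ∀ r : ℝ, k * r - ε⁻¹ * r ^ 2 ≤ k ^ 2 * ε := by
    intro r
    have : k ^ 2 * ε - (k * r - ε⁻¹ * r ^ 2) =
        ε⁻¹ * ((k * ε - r / 2) ^ 2 + 3 / 4 * r ^ 2) := by field_simp; ring
    have h2 : 0 ≤ ε⁻¹ * ((k * ε - r / 2) ^ 2 + 3 / 4 * r ^ 2) := by positivity
    linarith
  set I : ℝ → ℝ := fun s => ∫ r in t₀..s, g r with hI
  have hId : ContDiff ℝ 1 I := contDiff_integral_right hg t₀
  -- The penalty is centred on the moving point `X s`, so it is constant in the direction `(1, v)`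
  -- and contributes nothing to the test.
  set Ψ : ℝ × E → ℝ := fun z =>
    -u z.1 z.2 - I z.1 - η * (z.1 - t₀) + ε⁻¹ * ‖z.2 - X z.1‖ ^ 2 with hΨ
  set K := Metric.closedBall (0 : E) ρ with hK
  have hKc : IsCompact K := isCompact_closedBall _ _
  have hXK : ∀ s ∈ Icc t₀ t₁, X s ∈ K := fun s hs => by
    rw [hK, mem_closedBall_zero_iff]; linarith [hXρ s hs]
  have hΨc : ContinuousOn Ψ (Icc t₀ t₁ ×ˢ K) := by
    have h1 : ContinuousOn (fun z : ℝ × E => u z.1 z.2) (Icc t₀ t₁ ×ˢ K) :=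
      hk.continuousOn.mono (prod_mono hIcc subset_rfl)
    have h2 : Continuous (fun z : ℝ × E => I z.1) := hId.continuous.comp continuous_fst
    have h3 : Continuous (fun z : ℝ × E => ε⁻¹ * ‖z.2 - X z.1‖ ^ 2) := by fun_prop
    exact ((h1.neg.sub h2.continuousOn).sub (by fun_prop)).add h3.continuousOn
  obtain ⟨M, hM⟩ := (isCompact_Icc.prod hKc).bddBelow_image hΨc
  have hsub : Ioc t₀ t₁ ×ˢ K ⊆ Icc t₀ t₁ ×ˢ K := prod_mono Ioc_subset_Icc_self subset_rfl
  have hstart : ∀ δ > 0, ∃ z ∈ Ioo t₀ t₁ ×ˢ K, Ψ z < -u t₀ x₀ + δ := by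
    intro δ hδ
    have hq : ContinuousWithinAt (fun s => Ψ (s, X s)) (Icc t₀ t₁) t₀ := by
      have : ContinuousOn (fun s => Ψ (s, X s)) (Icc t₀ t₁) :=
        hΨc.comp (by fun_prop) (fun s hs => ⟨hs, hXK s hs⟩)
      exact this t₀ (left_mem_Icc.2 h01.le)
    have hq0 : Ψ (t₀, X t₀) = -u t₀ x₀ := by simp [hΨ, hX, hI]
    have hq' : Tendsto (fun s => Ψ (s, X s)) (𝓝[>] t₀) (𝓝 (-u t₀ x₀)) := by
      rw [← hq0, ← nhdsWithin_Ioo_eq_nhdsGT h01]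
      exact hq.mono_left (nhdsWithin_mono _ Ioo_subset_Icc_self)
    obtain ⟨s, hs, hs'⟩ := ((hq'.eventually_lt_const (by linarith : -u t₀ x₀ < -u t₀ x₀ + δ)).and
      (Ioo_mem_nhdsGT h01)).exists
    exact ⟨(s, X s), ⟨hs', hXK s (Ioo_subset_Icc_self hs')⟩, hs⟩
  have hend : ∀ y ∈ K, -u t₀ x₀ + D / 3 ≤ Ψ (t₁, y) := by
    intro y hy
    have e1 := abs_sub_le_of_lipschitzOnWith hk (hIcc t₁ (right_mem_Icc.2 h01.le))
      (mem_closedBall_zero_iff.1 hy) (mem_closedBall_zero_iff.1 (hXK t₁ (right_mem_Icc.2 h01.le)))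
    have e2 := le_abs_self (u t₁ y - u t₁ (X t₁))
    have e3 := hquad ‖y - X t₁‖
    have e4 : η * (t₁ - t₀) = D / 3 := by rw [hη]; field_simp
    have e5 : -u t₀ x₀ + D = -u t₁ (X t₁) - I t₁ := by rw [hD]; ring
    simp only [hΨ]
    rw [e4]
    linarith
  obtain ⟨κ, hκ, ⟨s, y⟩, ⟨hs, hy⟩, hmin⟩ := exists_penalized_min hKc (hΨc.mono hsub)
    (fun z hz => hM (mem_image_of_mem _ (hsub hz))) hstart (by positivity : 0 < D / 3) hend
  simp only at hs hy hmin
  have hsI : s ∈ Icc t₀ t₁ := Ioo_subset_Icc_self hs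
  -- Comparing the minimum with the point `X s` at the same time bounds the penalty by the Lipschitz
  -- variation of `u`.
  have hclose : ‖y - X s‖ ≤ k * ε := by
    have e0 := hmin (s, X s) ⟨Ioo_subset_Ioc_self hs, hXK s hsI⟩
    have e1 := abs_sub_le_of_lipschitzOnWith hk (hIcc s hsI)
      (mem_closedBall_zero_iff.1 hy) (mem_closedBall_zero_iff.1 (hXK s hsI))
    have e2 := le_abs_self (u s y - u s (X s))
    simp only [hΨ, sub_self, norm_zero] at e0
    have e3 : ε⁻¹ * ‖y - X s‖ ^ 2 ≤ k * ‖y - X s‖ := by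
      norm_num at e0
      linarith
    rcases (norm_nonneg (y - X s)).eq_or_lt with h | h
    · rw [← h]; positivity
    · have e4 : ε⁻¹ * ‖y - X s‖ ≤ k := by
        refine le_of_mul_le_mul_right ?_ h
        rw [mul_assoc, ← sq]; exact e3
      rwa [inv_mul_le_iff₀ hεpos, mul_comm] at e4
  have hyball : y ∈ Metric.ball (0 : E) ρ := by
    rw [mem_ball_zero_iff]
    have := norm_add_le (y - X s) (X s)
    rw [sub_add_cancel] at this
    linarith [hXρ s hsI]
  set φ : ℝ × E → ℝ := fun z =>
    -I z.1 - η * (z.1 - t₀) + ε⁻¹ * ‖z.2 - X z.1‖ ^ 2 + κ / (z.1 - t₀) with hφ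
  have hs0 : s - t₀ ≠ 0 := (sub_pos.2 hs.1).ne'
  have hφd : ContDiffAt ℝ 1 φ (s, y) := by
    have h1 : ContDiff ℝ 1 (fun z : ℝ × E => I z.1) := hId.comp contDiff_fst
    have h2 : ContDiff ℝ 1 (fun z : ℝ × E => ‖z.2 - X z.1‖ ^ 2) :=
      (contDiff_snd.sub (hXd.comp contDiff_fst)).norm_sq ℝ
    have h3 : ContDiff ℝ 1 (fun z : ℝ × E => z.1 - t₀) := contDiff_fst.sub contDiff_const
    exact (((h1.neg.sub (contDiff_const.mul h3)).add (contDiff_const.mul h2)).contDiffAt).add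
      (contDiffAt_const.div h3.contDiffAt hs0)
  have hmax : IsLocalMax (fun z : ℝ × E => u z.1 z.2 - φ z) (s, y) := by
    have hn : Ioo t₀ t₁ ×ˢ Metric.ball (0 : E) ρ ∈ 𝓝 (s, y) :=
      (isOpen_Ioo.prod Metric.isOpen_ball).mem_nhds ⟨hs, hyball⟩
    filter_upwards [hn] with z hz
    have := hmin z ⟨Ioo_subset_Ioc_self hz.1, Metric.ball_subset_closedBall hz.2⟩
    simp only [hΨ] at this
    simp only [hφ]
    linarith
  have hline : HasDerivAt (fun r : ℝ => φ (s + r, y + r • v))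
      (-g s - η - κ / (s - t₀) ^ 2) 0 := by
    have hsh : HasDerivAt (fun r : ℝ => s + r) 1 0 := (hasDerivAt_id (0 : ℝ)).const_add s
    have hI' : HasDerivAt (fun r : ℝ => I (s + r)) (g s) 0 := by
      have : HasDerivAt I (g s) (s + 0) := by
        rw [add_zero]; exact hasDerivAt_integral_right hg t₀ s
      exact this.comp_const_add _ _
    have hd : HasDerivAt (fun r : ℝ => s + r - t₀) 1 0 := hsh.sub_const t₀
    have hκ' := (hasDerivAt_const (0 : ℝ) κ).div hd (by simpa using hs0)
    have hall := ((hI'.neg.sub (hd.const_mul η)).add_const (ε⁻¹ * ‖y - X s‖ ^ 2)).add hκ'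
    refine (hall.congr_deriv ?_).congr_of_eventuallyEq (Eventually.of_forall fun r => ?_)
    · simp; ring
    · have : y + r • v - X (s + r) = y - X s := by
        simp only [hX, add_sub_right_comm s r t₀, add_smul]; abel
      simp only [hφ, this]
      rfl
  have hs0T : s ∈ Ioo 0 T := ⟨h0.trans_lt hs.1, hs.2.trans_le h1⟩
  have key := hu.sub s hs0T y φ hφd hmax v
  rw [fderiv_eq_of_hasDerivAt_line (hφd.differentiableAt (by norm_num)) hline] at key
  have k1 := hfg s hsI
  have k2 := (le_abs_self _).trans (hL.lipschitz_left y (X s) v)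
  have k3 := (le_abs_self _).trans (hu.lipschitz_space s y (X s))
  have k4 : Cv * ‖y - X s‖ ≤ Cv * k * ε := by rw [mul_assoc]; gcongr
  have k5 : 0 ≤ κ / (s - t₀) ^ 2 := by positivity
  have k6 : A * (1 + ‖v‖ ^ 2) * ‖y - X s‖ + A * ‖y - X s‖ = Cv * ‖y - X s‖ := by
    rw [hCv]; ring
  linarith

/-- The converse dynamic programming inequality over a short time step, up to an error of second
order. -/
theorem HJSolution.exists_step (hL : QuadraticLagrangian L a A) (hu : HJSolution L f T u A)
    (ρ : ℝ) : ∃ W C τ₀ : ℝ, 0 ≤ W ∧ 0 ≤ C ∧ 0 < τ₀ ∧ ∀ s τ : ℝ, ∀ x : E, 0 ≤ s → 0 < τ → τ ≤ τ₀ →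
      s + τ ≤ T → ‖x‖ ≤ ρ → ∃ w, ‖w‖ ≤ W ∧
        u (s + τ) (x + τ • w) + τ * L x w + ∫ r in s..s + τ, f r x ≤ u s x + C * τ ^ 2 := by
  obtain ⟨k, hk⟩ := hu.u_lipschitz (ρ + 1)
  have ha := hL.pos
  have hA : 0 < A := hL.pos.trans_le hL.le
  -- If moving with velocity `w` is no worse than resting, then `a|w|² ≤ k|w|`; the extra `1` keeps
  -- `W` positive.
  set W : ℝ := (k + 1) / a with hW
  have hWpos : 0 < W := by positivity
  set C₀ := A * (1 + 2 * W ^ 2) + A with hC₀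
  have hC₀pos : 0 < C₀ := by positivity
  -- The first condition keeps the step inside the unit ball around `x`. The second lets strong
  -- convexity absorb the `|v|²` error made by freezing the Lagrangian at `x`.
  obtain ⟨τ₀, ⟨hτ1, hτ2⟩, hτ₀⟩ := (((eventually_mul_lt W one_pos).and
    (eventually_mul_lt (2 * A * W) ha)).and self_mem_nhdsWithin).exists
  refine ⟨W, 2 * C₀ * W, τ₀, hWpos.le, by positivity, hτ₀, fun s τ x hs hτ hττ₀ hsT hx => ?_⟩
  -- Twice the freezing error `C₀ ‖y' - x‖ ≤ C₀ W τ`; over a time `τ` this rate produces the error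
  -- `C τ²`.
  set η := 2 * C₀ * W * τ with hη
  have hηpos : 0 < η := by positivity
  have hWτ : W * τ < 1 := by nlinarith
  have hAWτ : 2 * A * W * τ < a := by
    have : 2 * A * W * τ ≤ 2 * A * W * τ₀ := by gcongr
    linarith
  set I : ℝ → ℝ := fun s' => ∫ r in s..s', f r x with hI
  have hId : ContDiff ℝ 1 I := contDiff_integral_right (hu.continuous_time x) s
  set V : ℝ × E → E := fun z => (z.1 - s)⁻¹ • (z.2 - x) with hV
  set Φ : ℝ × E → ℝ := fun z => u z.1 z.2 + I z.1 - η * (z.1 - s) with hΦ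
  -- The added term is the cost of a straight path from `(s, x)` with the Lagrangian frozen at `x`.
  -- Its derivative along `(1, v)` is the tangent of `L x` at the path's velocity `w`, evaluated at
  -- `v`, which lies below `L x v` by at least `a ‖v - w‖²`.
  set Ψ : ℝ × E → ℝ := fun z => Φ z + (z.1 - s) * L x (V z) with hΨ
  set K := Metric.closedBall x 1 with hK
  have hKc : IsCompact K := isCompact_closedBall _ _
  have hxK : x ∈ K := Metric.mem_closedBall_self zero_le_one
  have hKρ : ∀ y ∈ K, ‖y‖ ≤ ρ + 1 := by
    intro y hy
    have h1 : ‖y - x‖ ≤ 1 := mem_closedBall_iff_norm.1 hy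
    have := norm_add_le (y - x) x
    rw [sub_add_cancel] at this
    linarith
  have hIcc : ∀ r ∈ Icc s (s + τ), r ∈ Icc 0 T := fun r hr => ⟨hs.trans hr.1, hr.2.trans hsT⟩
  have hΦc : ContinuousOn Φ (Icc s (s + τ) ×ˢ K) := by
    have h1 : ContinuousOn (fun z : ℝ × E => u z.1 z.2) (Icc s (s + τ) ×ˢ K) :=
      hk.continuousOn.mono (prod_mono hIcc fun y hy => by
        rw [mem_closedBall_zero_iff]; exact hKρ y hy)
    have h2 : Continuous (fun z : ℝ × E => I z.1) := hId.continuous.comp continuous_fst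
    exact (h1.add h2.continuousOn).sub (by fun_prop)
  have hsub : Ioc s (s + τ) ×ˢ K ⊆ Icc s (s + τ) ×ˢ K :=
    prod_mono Ioc_subset_Icc_self subset_rfl
  have hΨc : ContinuousOn Ψ (Ioc s (s + τ) ×ˢ K) := by
    have h1 : ContinuousOn (fun z : ℝ × E => z.1 - s) (Ioc s (s + τ) ×ˢ K) := by fun_prop
    have h2 : ContinuousOn V (Ioc s (s + τ) ×ˢ K) :=
      (h1.inv₀ fun z hz => (sub_pos.2 hz.1.1).ne').smul (by fun_prop)
    exact (hΦc.mono hsub).add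
      (h1.mul ((hL.contDiff x).continuous.comp_continuousOn h2))
  have hVbound : ∀ r ∈ Ioc s (s + τ), ∀ y ∈ K, Ψ (r, y) ≤ Ψ (r, x) → ‖V (r, y)‖ ≤ W := by
    intro r hr y hy hle
    have hr0 : 0 < r - s := sub_pos.2 hr.1
    have e1 := abs_sub_le_of_lipschitzOnWith hk (hIcc r (Ioc_subset_Icc_self hr))
      (hKρ y hy) (hKρ x hxK)
    have e2 := neg_abs_le (u r y - u r x)
    have e3 : y - x = (r - s) • V (r, y) := by
      simp only [hV, smul_smul, mul_inv_cancel₀ hr0.ne', one_smul]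
    rw [e3, norm_smul, Real.norm_of_nonneg hr0.le] at e1
    have e4 : V (r, x) = 0 := by simp [hV]
    simp only [hΨ, hΦ, e4] at hle
    have e5 := mul_le_mul_of_nonneg_left (hL.growth x (V (r, y))) hr0.le
    have e6 : (r - s) * (a * ‖V (r, y)‖ ^ 2) ≤ (r - s) * (k * ‖V (r, y)‖) := by nlinarith
    have e7 := le_of_mul_le_mul_left e6 hr0
    rw [hW, le_div_iff₀ ha]
    rcases (norm_nonneg (V (r, y))).eq_or_lt with h | h
    · rw [← h]; simp; positivity
    · have : a * ‖V (r, y)‖ ≤ k := by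
        refine le_of_mul_le_mul_right ?_ h
        rw [mul_assoc, ← sq]; exact e7
      linarith
  have hτmem : s + τ ∈ Ioc s (s + τ) := ⟨by linarith, le_rfl⟩
  obtain ⟨y, hy, hymin⟩ := hKc.exists_isMinOn ⟨x, hxK⟩ (f := fun y => Ψ (s + τ, y))
    (hΨc.comp (by fun_prop) fun y hy => ⟨hτmem, hy⟩)
  have hyx : x + τ • V (s + τ, y) = y := by
    simp only [hV, add_sub_cancel_left, smul_smul, mul_inv_cancel₀ hτ.ne', one_smul]
    abel
  refine ⟨V (s + τ, y), hVbound _ hτmem y hy (hymin hxK), ?_⟩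
  rw [hyx]
  suffices h : Ψ (s + τ, y) ≤ u s x by
    have e : η * τ = 2 * C₀ * W * τ ^ 2 := by rw [hη]; ring
    simp only [hΨ, hΦ, hI, add_sub_cancel_left] at h
    linarith
  by_contra! hcon
  obtain ⟨M, hM⟩ := (isCompact_Icc.prod hKc).bddBelow_image hΦc
  have hLx0 : -A ≤ L x 0 := by linarith [hu.nonneg s x, le_abs_self (f s x), hu.bounded s x]
  have hMΨ : ∀ z ∈ Ioc s (s + τ) ×ˢ K, M - τ * A ≤ Ψ z := by
    intro z hz
    have e1 : M ≤ Φ z := hM (mem_image_of_mem _ (hsub hz))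
    have e2 : -A ≤ L x (V z) := by
      have := hL.growth x (V z)
      have : 0 ≤ a * ‖V z‖ ^ 2 := by positivity
      linarith
    have e3 : 0 < z.1 - s := sub_pos.2 hz.1.1
    have e4 : z.1 - s ≤ τ := by linarith [hz.1.2]
    simp only [hΨ]
    nlinarith
  have hstart : ∀ δ > 0, ∃ z ∈ Ioo s (s + τ) ×ˢ K, Ψ z < u s x + δ := by
    intro δ hδ
    have hq : ContinuousOn (fun r => Φ (r, x) + (r - s) * L x 0) (Icc s (s + τ)) :=
      (hΦc.comp (by fun_prop) (fun r hr => ⟨hr, hxK⟩)).add (by fun_prop)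
    have hq0 : Φ (s, x) + (s - s) * L x 0 = u s x := by simp [hΦ, hI]
    have hss : s < s + τ := by linarith
    have hq' : Tendsto (fun r => Φ (r, x) + (r - s) * L x 0) (𝓝[>] s) (𝓝 (u s x)) := by
      rw [← nhdsWithin_Ioo_eq_nhdsGT hss]
      have := (hq s (left_mem_Icc.2 hss.le)).mono_left
        (nhdsWithin_mono s (Ioo_subset_Icc_self (a := s) (b := s + τ)))
      rw [← hq0]
      exact this
    obtain ⟨r, hr, hr'⟩ := ((hq'.eventually_lt_const (by linarith : u s x < u s x + δ)).and
      (Ioo_mem_nhdsGT hss)).exists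
    refine ⟨(r, x), ⟨hr', hxK⟩, ?_⟩
    have e4 : V (r, x) = 0 := by simp [hV]
    simpa only [hΨ, e4] using hr
  obtain ⟨κ, hκ, ⟨r, y'⟩, ⟨hr, hy'⟩, hmin⟩ := exists_penalized_min hKc hΨc hMΨ hstart
    (sub_pos.2 hcon) (fun z hz => by rw [add_sub_cancel]; exact hymin hz)
  simp only at hr hy' hmin
  have hrI : r ∈ Ioc s (s + τ) := Ioo_subset_Ioc_self hr
  have hr0 : 0 < r - s := sub_pos.2 hr.1
  set w := V (r, y') with hw
  have hwW : ‖w‖ ≤ W := by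
    refine hVbound r hrI y' hy' ?_
    have := hmin (r, x) ⟨hrI, hxK⟩
    simpa using this
  have hy'x : y' - x = (r - s) • w := by
    simp only [hw, hV, smul_smul, mul_inv_cancel₀ hr0.ne', one_smul]
  have hdist : ‖y' - x‖ ≤ W * τ := by
    rw [hy'x, norm_smul, Real.norm_of_nonneg hr0.le, mul_comm]
    have : r - s ≤ τ := by linarith [hr.2]
    gcongr
  have hyball : y' ∈ Metric.ball x 1 := by
    rw [mem_ball_iff_norm]; linarith
  set φ : ℝ × E → ℝ := fun z =>
    -(I z.1 - η * (z.1 - s) + (z.1 - s) * L x (V z) + κ / (z.1 - s)) with hφ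
  have hφd : ContDiffAt ℝ 1 φ (r, y') := by
    have h1 : ContDiffAt ℝ 1 (fun z : ℝ × E => I z.1) (r, y') :=
      (hId.comp contDiff_fst).contDiffAt
    have h3 : ContDiffAt ℝ 1 (fun z : ℝ × E => z.1 - s) (r, y') :=
      (contDiff_fst.sub contDiff_const).contDiffAt
    have h4 : ContDiffAt ℝ 1 V (r, y') :=
      (h3.inv hr0.ne').smul (contDiff_snd.sub contDiff_const).contDiffAt
    exact (((h1.sub (contDiffAt_const.mul h3)).add
      (h3.mul ((hL.contDiff x).contDiffAt.comp _ h4))).add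
      (contDiffAt_const.div h3 hr0.ne')).neg
  have hlmin : IsLocalMin (fun z : ℝ × E => u z.1 z.2 - φ z) (r, y') := by
    have hn : Ioo s (s + τ) ×ˢ Metric.ball x 1 ∈ 𝓝 (r, y') :=
      (isOpen_Ioo.prod Metric.isOpen_ball).mem_nhds ⟨hr, hyball⟩
    filter_upwards [hn] with z hz
    have := hmin z ⟨Ioo_subset_Ioc_self hz.1, Metric.ball_subset_closedBall hz.2⟩
    simp only [hΨ, hΦ] at this
    simp only [hφ]
    linarith
  have hline : ∀ v : E, HasDerivAt (fun q : ℝ => φ (r + q, y' + q • v))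
      (-(f r x - η + (L x w + fderiv ℝ (L x) w (v - w)) - κ / (r - s) ^ 2)) 0 := by
    intro v
    have hsh : HasDerivAt (fun q : ℝ => r + q) 1 0 := (hasDerivAt_id (0 : ℝ)).const_add r
    have hI' : HasDerivAt (fun q : ℝ => I (r + q)) (f r x) 0 := by
      have : HasDerivAt I (f r x) (r + 0) := by
        rw [add_zero]; exact hasDerivAt_integral_right (hu.continuous_time x) s r
      exact this.comp_const_add _ _
    have hd : HasDerivAt (fun q : ℝ => r + q - s) 1 0 := hsh.sub_const s
    have hd0 : r + 0 - s ≠ 0 := by simpa using hr0.ne'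
    have hκ' := (hasDerivAt_const (0 : ℝ) κ).div hd hd0
    have hy2 : HasDerivAt (fun q : ℝ => y' + q • v - x) v 0 := by
      simpa using (((hasDerivAt_id (0 : ℝ)).smul_const v).const_add y').sub_const x
    have hVd : HasDerivAt (fun q : ℝ => V (r + q, y' + q • v)) ((r - s)⁻¹ • (v - w)) 0 := by
      refine ((hd.inv hd0).smul hy2).congr_deriv ?_
      simp only [add_zero, zero_smul, hy'x, Pi.inv_apply]
      match_scalars <;> field_simp
    have hLd : HasDerivAt (fun q : ℝ => L x (V (r + q, y' + q • v)))
        (fderiv ℝ (L x) w ((r - s)⁻¹ • (v - w))) 0 := by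
      have h0 : V (r + 0, y' + (0 : ℝ) • v) = w := by simp [hw]
      have h1 : HasFDerivAt (L x) (fderiv ℝ (L x) w) (V (r + 0, y' + (0 : ℝ) • v)) := by
        rw [h0]; exact ((hL.contDiff x).differentiable (by norm_num) w).hasFDerivAt
      exact h1.comp_hasDerivAt (0 : ℝ) hVd
    have hall := (((hI'.sub (hd.const_mul η)).add (hd.mul hLd)).add hκ').neg
    refine hall.congr_deriv ?_
    have h0 : V (r + 0, y' + (0 : ℝ) • v) = w := by simp [hw]
    simp only [h0]
    simp only [map_smul, smul_eq_mul, add_zero]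
    field_simp
    ring
  have hrT : r ∈ Ioo 0 T := ⟨hs.trans_lt hr.1, hr.2.trans_le hsT⟩
  obtain ⟨v, hv⟩ := hu.super r hrT y' φ hφd hlmin (η / 2) (half_pos hηpos)
  rw [fderiv_eq_of_hasDerivAt_line (hφd.differentiableAt (by norm_num)) (hline v)] at hv
  set d := ‖y' - x‖ with hd
  have hd0 : 0 ≤ d := norm_nonneg _
  have e1 := (abs_le.1 (hL.lipschitz_left y' x v)).1
  have e2 := (abs_le.1 (hu.lipschitz_space r y' x)).1
  have e3 := hL.convex x v w
  have e4 : ‖v‖ ^ 2 ≤ 2 * W ^ 2 + 2 * ‖v - w‖ ^ 2 := by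
    have h1 := norm_add_le (v - w) w
    rw [sub_add_cancel] at h1
    nlinarith [norm_nonneg v, norm_nonneg w, sq_nonneg (‖v - w‖ - ‖w‖)]
  have e5 : A * (1 + ‖v‖ ^ 2) * d ≤ A * (1 + 2 * W ^ 2) * d + a * ‖v - w‖ ^ 2 := by
    have h1 : 2 * A * d ≤ a := by
      have : 2 * A * d ≤ 2 * A * (W * τ) := by gcongr
      linarith
    have h2 : A * (1 + ‖v‖ ^ 2) * d ≤ A * (1 + (2 * W ^ 2 + 2 * ‖v - w‖ ^ 2)) * d := by gcongr
    have h3 := mul_le_mul_of_nonneg_right h1 (sq_nonneg ‖v - w‖)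
    linarith
  have e6 : C₀ * d ≤ η / 2 := by
    have : C₀ * d ≤ C₀ * (W * τ) := by gcongr
    rw [hη]; linarith
  have e7 : A * (1 + 2 * W ^ 2) * d + A * d = C₀ * d := by rw [hC₀]; ring
  have e8 : 0 ≤ κ / (r - s) ^ 2 := by positivity
  linarith

end DynamicProgramming

/-! ### Nearly optimal polygons and their translates -/

section Polygon

/-- A Cauchy-Schwarz inequality. It makes `u(s, y) + a |y|² / (s - t₀)` nonincreasing along polygons
up to the step error. -/
theorem norm_add_sq_div_le {X : Type*} [SeminormedAddCommGroup X] (p q : X) {α β : ℝ}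
    (hα : 0 < α) (hβ : 0 < β) : ‖p + q‖ ^ 2 / (α + β) ≤ ‖p‖ ^ 2 / α + ‖q‖ ^ 2 / β := by
  have h1 : ‖p + q‖ ^ 2 ≤ (‖p‖ + ‖q‖) ^ 2 := by gcongr; exact norm_add_le p q
  have h2 : (‖p‖ + ‖q‖) ^ 2 / (α + β) ≤ ‖p‖ ^ 2 / α + ‖q‖ ^ 2 / β := by
    rw [div_add_div _ _ hα.ne' hβ.ne', div_le_div_iff₀ (by positivity) (by positivity)]
    have : 0 ≤ (‖p‖ * β - ‖q‖ * α) ^ 2 := sq_nonneg _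
    linarith [this]
  exact (by gcongr : ‖p + q‖ ^ 2 / (α + β) ≤ (‖p‖ + ‖q‖) ^ 2 / (α + β)).trans h2

/-- The constant that governs the cost of translating trajectories by vectors of norm at most
`D`. -/
def translationConst (A D : ℝ) : ℝ := A * (3 + D + 2 * D ^ 2)

variable {E : Type*} [NormedAddCommGroup E] [InnerProductSpace ℝ E] [FiniteDimensional ℝ E]
variable {L : E → E → ℝ} {f : ℝ → E → ℝ} {T a A : ℝ} {u : ℝ → E → ℝ}

/-- The competitor runs from `x + θh` with velocity `w - h`. The `|w|²` part of its extra cost is at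
most a multiple of `‖h‖` times the step cost `J`, because `J ≥ aτ|w|²`. Since `J` is bounded by the
drop of `u`, this part is absorbed into the factor `1 + B / a * ‖h‖`. -/
theorem HJSolution.exists_step_translate (hL : QuadraticLagrangian L a A)
    (hu : HJSolution L f T u A) (ρ : ℝ) {D : ℝ} (hD : 0 ≤ D) :
    ∃ C τ₀ : ℝ, 0 ≤ C ∧ 0 < τ₀ ∧ ∀ s τ θ : ℝ, ∀ x h : E, 0 ≤ s → 0 < τ → τ ≤ τ₀ → s + τ ≤ T →
      0 ≤ θ → θ ≤ 1 → ‖x‖ ≤ ρ → ‖h‖ ≤ D → ∃ y,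
        u (s + τ) y + a * (‖y - x‖ ^ 2 / τ) ≤ u s x + C * τ ^ 2 ∧
        u s (x + θ • h) - (1 + translationConst A D / a * ‖h‖) * u s x ≤
          u (s + τ) (y + (θ - τ) • h) - (1 + translationConst A D / a * ‖h‖) * u (s + τ) y +
            translationConst A D * ‖h‖ * τ + C * τ ^ 2 := by
  obtain ⟨W, C₀, τ₀, hW, hC₀, hτ₀, hstep⟩ := hu.exists_step hL ρ
  have ha := hL.pos
  have hA : 0 < A := hL.pos.trans_le hL.le
  set B := translationConst A D with hB
  have hBpos : 0 < B := by rw [hB, translationConst]; positivity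
  set C₁ := A * (2 + 2 * W ^ 2 + 2 * D ^ 2) * (W + D) with hC₁
  have hC₁pos : 0 ≤ C₁ := by positivity
  refine ⟨C₁ + (1 + B / a * D) * C₀, τ₀, by positivity, hτ₀, ?_⟩
  intro s τ θ x h hs hτ hττ₀ hsT hθ0 hθ1 hx hh
  obtain ⟨w, hwW, hw⟩ := hstep s τ x hs hτ hττ₀ hsT hx
  set y := x + τ • w with hy
  have hint : IntervalIntegrable (fun r => f r x) volume s (s + τ) :=
    (hu.continuous_time x).intervalIntegrable _ _
  set J := τ * L x w + ∫ r in s..s + τ, f r x with hJ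
  have hconst : ∀ c : ℝ, ∫ r in s..s + τ, (f r x + c) = (∫ r in s..s + τ, f r x) + τ * c := by
    intro c
    rw [intervalIntegral.integral_add hint (continuous_const.intervalIntegrable _ _)]
    simp
  have hJlow : a * (τ * ‖w‖ ^ 2) ≤ J := by
    have h1 : ∫ r in s..s + τ, (a * ‖w‖ ^ 2) ≤ ∫ r in s..s + τ, (f r x + L x w) := by
      refine intervalIntegral.integral_mono_on (by linarith)
        (continuous_const.intervalIntegrable _ _)
        (hint.add (continuous_const.intervalIntegrable _ _)) fun r _ => ?_
      linarith [hL.growth x w, hu.nonneg r x]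
    rw [hconst] at h1
    simp at h1
    linarith
  have hκ : 1 ≤ 1 + B / a * ‖h‖ := by
    have : 0 ≤ B / a * ‖h‖ := by positivity
    linarith
  have hκD : 1 + B / a * ‖h‖ ≤ 1 + B / a * D := by gcongr
  have hyx : ‖y - x‖ ^ 2 / τ = τ * ‖w‖ ^ 2 := by
    rw [hy, add_sub_cancel_left, norm_smul, Real.norm_of_nonneg hτ.le]
    field_simp
  refine ⟨y, ?_, ?_⟩
  · rw [hyx]
    have h1 : C₀ ≤ C₁ + (1 + B / a * D) * C₀ := by
      have : 0 ≤ B / a * D * C₀ := by positivity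
      linarith
    have h2 := mul_le_mul_of_nonneg_right h1 (sq_nonneg τ)
    linarith
  set e := ‖h‖ + τ * (W + D) with he
  set c := A * (2 + 2 * ‖w‖ ^ 2 + 2 * D ^ 2) * e + A * ‖h‖ * (1 + ‖w‖ ^ 2 + D) with hc
  have hwh : ‖w - h‖ ≤ W + D := (norm_sub_le _ _).trans (add_le_add hwW hh)
  have hwh2 : ‖w - h‖ ^ 2 ≤ 2 * ‖w‖ ^ 2 + 2 * D ^ 2 := by
    have h1 := norm_sub_le w h
    have h2 : ‖w - h‖ ^ 2 ≤ (‖w‖ + ‖h‖) ^ 2 := by gcongr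
    have h3 : ‖h‖ ^ 2 ≤ D ^ 2 := by gcongr
    linarith [sq_nonneg (‖w‖ - ‖h‖)]
  have hseg := hu.le_add_integral hL hs (by linarith : s < s + τ) hsT (x + θ • h) (w - h)
    (g := fun r => f r x + (L x w + c)) ((hu.continuous_time x).add continuous_const) ?_
  · rw [hconst] at hseg
    have hend : x + θ • h + (s + τ - s) • (w - h) = y + (θ - τ) • h := by
      rw [hy, add_sub_cancel_left]; module
    rw [hend] at hseg
    have h1 : A * (2 + 2 * ‖w‖ ^ 2 + 2 * D ^ 2) * (τ * (W + D)) ≤ C₁ * τ := by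
      have : A * (2 + 2 * ‖w‖ ^ 2 + 2 * D ^ 2) ≤ A * (2 + 2 * W ^ 2 + 2 * D ^ 2) := by gcongr
      have h2 := mul_le_mul_of_nonneg_right this (by positivity : 0 ≤ τ * (W + D))
      rw [hC₁]; linarith
    have h2 : A * (2 + 2 * ‖w‖ ^ 2 + 2 * D ^ 2) * ‖h‖ + A * ‖h‖ * (1 + ‖w‖ ^ 2 + D) ≤
        B * ‖h‖ * (1 + ‖w‖ ^ 2) := by
      have : 0 ≤ A * ‖h‖ * (D + 2 * D ^ 2) * ‖w‖ ^ 2 := by positivity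
      rw [hB, translationConst]; linarith
    have h3 : c ≤ B * ‖h‖ * (1 + ‖w‖ ^ 2) + C₁ * τ := by rw [hc, he]; linarith
    have h4 := mul_le_mul_of_nonneg_left h3 hτ.le
    have h5 : B * ‖h‖ * (τ * ‖w‖ ^ 2) ≤ B / a * ‖h‖ * J := by
      have := mul_le_mul_of_nonneg_left hJlow (by positivity : 0 ≤ B / a * ‖h‖)
      calc _ = B / a * ‖h‖ * (a * (τ * ‖w‖ ^ 2)) := by field_simp
        _ ≤ _ := this
    have h6 : (1 + B / a * ‖h‖) * (u (s + τ) y + J) ≤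
        (1 + B / a * ‖h‖) * (u s x + C₀ * τ ^ 2) :=
      mul_le_mul_of_nonneg_left (by rw [hJ]; linarith) (by linarith)
    have h7 : (1 + B / a * ‖h‖) * (C₀ * τ ^ 2) ≤ (1 + B / a * D) * (C₀ * τ ^ 2) := by gcongr
    linarith
  · intro r hr
    set z := x + θ • h + (r - s) • (w - h) with hz
    have hzx : ‖z - x‖ ≤ e := by
      have : z - x = θ • h + (r - s) • (w - h) := by rw [hz]; abel
      rw [this]
      refine (norm_add_le _ _).trans ?_
      rw [norm_smul, norm_smul, Real.norm_of_nonneg hθ0, Real.norm_of_nonneg (sub_nonneg.2 hr.1)]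
      have h1 : θ * ‖h‖ ≤ ‖h‖ := mul_le_of_le_one_left (norm_nonneg _) hθ1
      have h2 : (r - s) * ‖w - h‖ ≤ τ * (W + D) := by
        have : r - s ≤ τ := by linarith [hr.2]
        gcongr
      linarith
    have e1 := (abs_le.1 (hL.lipschitz_left z x (w - h))).2
    have e2 := hL.lipschitz_right x w h
    have e3 := (abs_le.1 (hu.lipschitz_space r z x)).2
    have e4 : A * (1 + ‖w - h‖ ^ 2) * ‖z - x‖ ≤ A * (1 + (2 * ‖w‖ ^ 2 + 2 * D ^ 2)) * e := by
      gcongr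
    have e5 : A * ‖z - x‖ ≤ A * e := by gcongr
    have e6 : A * ‖h‖ * (1 + ‖w‖ ^ 2 + ‖h‖) ≤ A * ‖h‖ * (1 + ‖w‖ ^ 2 + D) := by gcongr
    rw [hc]
    linarith

/-- Follow nearly optimal polygons from `(t, x)` up to time `S`. The function
`u(s, y) + a |y|² / (s - t₀)` confines them, and the translated polygon, whose displacement
decreases from `h` at unit rate, is an admissible competitor. -/
theorem HJSolution.exists_endpoint (hL : QuadraticLagrangian L a A) (hu : HJSolution L f T u A)
    {ρ D Λ t₀ t S : ℝ} {x h : E} (ht : 0 ≤ t) (ht₀ : t₀ < t) (htS : t < S) (hST : S ≤ T)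
    (hSt : S - t ≤ 1) (hh : ‖h‖ ≤ D) (hΛ : u t x + a * (‖x‖ ^ 2 / (t - t₀)) < Λ)
    (hcoer : ∀ s ∈ Icc t S, ∀ y, u s y + a * (‖y‖ ^ 2 / (s - t₀)) ≤ Λ → ‖y‖ ≤ ρ)
    {ε : ℝ} (hε : 0 < ε) : ∃ y, u S y ≤ u t x + ε ∧
      u t (x + h) - (1 + translationConst A D / a * ‖h‖) * u t x ≤
        u S (y + (1 - (S - t)) • h) - (1 + translationConst A D / a * ‖h‖) * u S y +
          translationConst A D * ‖h‖ * (S - t) + ε := by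
  obtain ⟨C, τ₀, hC, hτ₀, hstep⟩ := hu.exists_step_translate hL ρ ((norm_nonneg h).trans hh)
  have ha := hL.pos
  set B := translationConst A D with hB
  set κ := 1 + B / a * ‖h‖ with hκ
  set G := u t x + a * (‖x‖ ^ 2 / (t - t₀)) with hG
  have hpos : 0 < S - t := sub_pos.2 htS
  -- Steps this short keep the accumulated error below both `ε` and the slack `Λ - G`; the slack
  -- keeps every vertex in the coercive sublevel set.
  set m := min τ₀ (min ε (Λ - G) / (C * (S - t) + 1)) with hm
  have hm1 : 0 < min ε (Λ - G) := lt_min hε (sub_pos.2 hΛ)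
  have hmpos : 0 < m := lt_min hτ₀ (by positivity)
  obtain ⟨N, hNm, hN⟩ := (((tendsto_const_div_atTop_nhds_zero_nat (S - t)).eventually_lt_const
    hmpos).and (eventually_gt_atTop 0)).exists
  have hN' : (0 : ℝ) < N := Nat.cast_pos.2 hN
  set τ := (S - t) / N with hτ
  have hτpos : 0 < τ := by positivity
  have hNτ : N * τ = S - t := by rw [hτ]; field_simp
  have herr : N * (C * τ ^ 2) ≤ min ε (Λ - G) := by
    have h1 : τ ≤ min ε (Λ - G) / (C * (S - t) + 1) := hNm.le.trans (min_le_right _ _)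
    rw [le_div_iff₀ (by positivity)] at h1
    calc N * (C * τ ^ 2) = C * (N * τ) * τ := by ring
      _ = τ * (C * (S - t)) := by rw [hNτ]; ring
      _ ≤ τ * (C * (S - t) + 1) := by gcongr; linarith
      _ ≤ _ := h1
  have hind : ∀ i : ℕ, i ≤ N → ∃ y,
      u (t + i * τ) y + a * (‖y‖ ^ 2 / (t + i * τ - t₀)) ≤ G + i * (C * τ ^ 2) ∧
      u (t + i * τ) y ≤ u t x + i * (C * τ ^ 2) ∧
      u t (x + h) - κ * u t x ≤ u (t + i * τ) (y + (1 - i * τ) • h) - κ * u (t + i * τ) y +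
        B * ‖h‖ * (i * τ) + i * (C * τ ^ 2) := by
    intro i
    induction i with
    | zero => intro _; exact ⟨x, by simp [hG], by simp, by simp⟩
    | succ i ih =>
      intro hi
      obtain ⟨y, hy1, hy2, hy3⟩ := ih (by omega)
      have hiN : (i : ℝ) + 1 ≤ N := by exact_mod_cast hi
      have hi0 : (0 : ℝ) ≤ i := Nat.cast_nonneg i
      have hiτ : i * τ + τ ≤ S - t := by
        rw [← hNτ]
        have := mul_le_mul_of_nonneg_right hiN hτpos.le
        linarith
      have hiτ0 : 0 ≤ i * τ := by positivity
      have hyρ : ‖y‖ ≤ ρ := by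
        refine hcoer (t + i * τ) ⟨by linarith, by linarith⟩ y (hy1.trans ?_)
        have h1 : i * (C * τ ^ 2) ≤ N * (C * τ ^ 2) := by
          gcongr; linarith
        linarith [herr.trans (min_le_right _ _)]
      obtain ⟨y', h1, h2⟩ := hstep (t + i * τ) τ (1 - i * τ) y h (by linarith) hτpos
        (hNm.le.trans (min_le_left _ _)) (by linarith) (by linarith) (by linarith) hyρ hh
      have e1 : t + ((i + 1 : ℕ) : ℝ) * τ = t + i * τ + τ := by push_cast; ring
      have e2 : 1 - ((i + 1 : ℕ) : ℝ) * τ = 1 - i * τ - τ := by push_cast; ring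
      have e3 : ((i + 1 : ℕ) : ℝ) * (C * τ ^ 2) = i * (C * τ ^ 2) + C * τ ^ 2 := by
        push_cast; ring
      have e4 : ((i + 1 : ℕ) : ℝ) * τ = i * τ + τ := by push_cast; ring
      rw [e2, e1, e3, e4]
      have h3 : a * (‖y - y'‖ ^ 2 / τ) ≥ 0 := by positivity
      rw [norm_sub_rev] at h3
      refine ⟨y', ?_, by linarith, by linarith⟩
      have h4 := norm_add_sq_div_le y (y' - y) (by linarith : 0 < t + i * τ - t₀) hτpos
      rw [add_sub_cancel] at h4
      have h5 := mul_le_mul_of_nonneg_left h4 ha.le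
      rw [show t + i * τ + τ - t₀ = t + i * τ - t₀ + τ by ring]
      linarith
  obtain ⟨y, -, hy2, hy3⟩ := hind N le_rfl
  rw [hNτ, add_sub_cancel] at hy2 hy3
  have := herr.trans (min_le_left _ _)
  exact ⟨y, by linarith, by linarith⟩

end Polygon

/-! ### Bounds uniform in the horizon -/

section Bounds

variable {E : Type*} [NormedAddCommGroup E] [InnerProductSpace ℝ E] [FiniteDimensional ℝ E]
variable {L : E → E → ℝ} {f : ℝ → E → ℝ} {T a A : ℝ} {u : ℝ → E → ℝ}

theorem HJSolution.le_add_quadratic (hL : QuadraticLagrangian L a A) (hu : HJSolution L f T u A)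
    {t₀ t₁ : ℝ} (h0 : 0 ≤ t₀) (h01 : t₀ < t₁) (h1 : t₁ ≤ T) (x y : E) :
    u t₀ x ≤ u t₁ y + 2 * A * (t₁ - t₀) + A * ‖y - x‖ ^ 2 / (t₁ - t₀) := by
  have ht : 0 < t₁ - t₀ := sub_pos.2 h01
  set v := (t₁ - t₀)⁻¹ • (y - x) with hv
  have hend : x + (t₁ - t₀) • v = y := by
    rw [hv, smul_smul, mul_inv_cancel₀ ht.ne', one_smul]; abel
  have := hu.le_add_integral hL h0 h01 h1 x v (g := fun _ => A * (1 + ‖v‖ ^ 2) + A)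
    continuous_const fun r _ => add_le_add (hL.upper _ _) ((le_abs_self _).trans (hu.bounded _ _))
  rw [hend, intervalIntegral.integral_const, smul_eq_mul] at this
  have hn : ‖v‖ ^ 2 = ‖y - x‖ ^ 2 / (t₁ - t₀) ^ 2 := by
    rw [hv, norm_smul, norm_inv, Real.norm_of_nonneg ht.le, mul_pow, inv_pow]
    field_simp
  refine this.trans_eq ?_
  rw [hn]
  field_simp
  ring

/-- A lower bound for the terminal values is a lower bound at all times. No growth condition is
imposed: the inequality `u(0,0) ≤ u(s,y) + C |y|² / s + C` provides a quadratic lower bound. -/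
theorem HJSolution.lower_bound (hL : QuadraticLagrangian L a A) (hu : HJSolution L f T u A)
    {c : ℝ} (hc : ∀ x, c ≤ u T x) {t : ℝ} (ht : t ∈ Icc 0 T) (x : E) : c ≤ u t x := by
  have ha := hL.pos
  have hA : 0 < A := hL.pos.trans_le hL.le
  have hmain : ∀ s₀ : ℝ, 0 < s₀ → s₀ ≤ 1 → ∀ n : ℕ, ∀ t, s₀ ≤ t → t ≤ T →
      T - t ≤ n * (a * s₀ / (4 * A)) → ∀ x, c ≤ u t x := by
    intro s₀ hs₀ hs₁ n
    -- With `t₀ = t - ϑ` the confining term is at least `a|y|² / (2ϑ) = 2A|y|² / s₀`, twice the loss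
    -- in the quadratic lower bound for `u`. Hence the backward induction advances by `ϑ`.
    set ϑ := a * s₀ / (4 * A) with hϑ
    have hϑpos : 0 < ϑ := by positivity
    have hϑ1 : ϑ ≤ 1 := by
      rw [hϑ, div_le_one (by positivity)]
      have : a * s₀ ≤ A * 1 := by gcongr; exact hL.le
      linarith
    induction n with
    | zero =>
      intro t _ htT h x
      have : t = T := by
        simp only [Nat.cast_zero, zero_mul] at h; linarith
      rw [this]; exact hc x
    | succ n ih =>
      intro t hst htT h x
      rcases htT.eq_or_lt with rfl | htT'
      · exact hc x
      set S := min T (t + ϑ) with hS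
      have hST : S ≤ T := min_le_left _ _
      have hSϑ : S ≤ t + ϑ := min_le_right _ _
      have htS : t < S := lt_min htT' (by linarith)
      have hlow : ∀ x, c ≤ u S x := by
        refine ih S (hst.trans htS.le) hST ?_
        push_cast at h
        rcases min_choice T (t + ϑ) with h' | h'
        · rw [hS, h', sub_self]; positivity
        · rw [hS, h']; linarith
      set Λ := u t x + a * (‖x‖ ^ 2 / (t - (t - ϑ))) + 1 with hΛ
      refine le_of_forall_pos_le_add fun ε hε => ?_
      have hcoer : ∀ s ∈ Icc t S, ∀ y, u s y + a * (‖y‖ ^ 2 / (s - (t - ϑ))) ≤ Λ →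
          ‖y‖ ≤ √((Λ - u 0 0 + 2 * A * T) * s₀ / A) := by
        intro s hs y hy
        have hs0 : s₀ ≤ s := hst.trans hs.1
        have e1 := hu.le_add_quadratic hL le_rfl (hs₀.trans_le hs0) (hs.2.trans hST) 0 y
        rw [sub_zero, sub_zero] at e1
        have e2 : A * ‖y‖ ^ 2 / s ≤ A * ‖y‖ ^ 2 / s₀ := by gcongr
        have e3 : 2 * A * s ≤ 2 * A * T := by gcongr; exact hs.2.trans hST
        have e4 : 2 * (A * ‖y‖ ^ 2 / s₀) ≤ a * (‖y‖ ^ 2 / (s - (t - ϑ))) := by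
          have h1 : s - (t - ϑ) ≤ 2 * ϑ := by linarith [hs.2]
          have h2 : 0 < s - (t - ϑ) := by linarith [hs.1]
          calc 2 * (A * ‖y‖ ^ 2 / s₀) = a * (‖y‖ ^ 2 / (2 * ϑ)) := by rw [hϑ]; field_simp; ring
            _ ≤ _ := by gcongr
        have e5 : A * ‖y‖ ^ 2 / s₀ ≤ Λ - u 0 0 + 2 * A * T := by linarith
        rw [div_le_iff₀ hs₀] at e5
        rw [← abs_of_nonneg (norm_nonneg y)]
        refine Real.abs_le_sqrt ?_
        rw [le_div_iff₀ hA]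
        linarith
      obtain ⟨y, hy, -⟩ := hu.exists_endpoint hL (D := 0) (Λ := Λ) (t₀ := t - ϑ) (x := x) (h := 0)
        (ρ := √((Λ - u 0 0 + 2 * A * T) * s₀ / A)) (by linarith) (by linarith) htS hST (by linarith)
        (by simp) (by linarith) hcoer hε
      linarith [hlow y]
  -- The quadratic bound degenerates as time tends to zero, so `t = 0` is reached by continuity.
  have hpos : ∀ t ∈ Ioc 0 T, c ≤ u t x := by
    intro t ht
    have hs : 0 < min 1 t := lt_min one_pos ht.1
    obtain ⟨n, hn⟩ := exists_nat_ge ((T - t) / (a * min 1 t / (4 * A)))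
    rw [div_le_iff₀ (by positivity)] at hn
    exact hmain _ hs (min_le_left _ _) n t (min_le_right _ _) ht.2 hn x
  rcases ht.1.eq_or_lt with h | h
  · subst h
    rcases ht.2.eq_or_lt with rfl | hT
    · exact hc x
    obtain ⟨k, hk⟩ := hu.u_lipschitz ‖x‖
    have hcont : ContinuousOn (fun s => u s x) (Icc 0 T) :=
      hk.continuousOn.comp (f := fun s => (s, x)) (by fun_prop) fun s hs => ⟨hs, by simp⟩
    have hlim : Tendsto (fun s => u s x) (𝓝[>] 0) (𝓝 (u 0 x)) := by
      rw [← nhdsWithin_Ioc_eq_nhdsGT hT]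
      exact (hcont 0 (left_mem_Icc.2 hT.le)).mono_left (nhdsWithin_mono _ Ioc_subset_Icc_self)
    refine ge_of_tendsto hlim ?_
    filter_upwards [Ioc_mem_nhdsGT hT] with s hs using hpos s hs
  · exact hpos t ⟨h, ht.2⟩

/-- Move to `xb` in unit time and rest there at no cost; if at most unit time is left, stay at `x`.
-/
theorem HJSolution.upper_bound (hL : QuadraticLagrangian L a A) (hu : HJSolution L f T u A)
    {k R : ℝ} (hk : ∀ x y, |u T x - u T y| ≤ k * ‖x - y‖) (hk0 : 0 ≤ k) {xb : E}
    (hxb : ∀ t, L xb 0 + f t xb ≤ 0) (hxbR : ‖xb‖ ≤ R) {t : ℝ} (ht : 0 ≤ t) (htT : t < T) {x : E}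
    (hx : ‖x‖ ≤ R) : u t x ≤ u T 0 + k * R + 2 * A + 4 * A * R ^ 2 := by
  have hA : 0 < A := hL.pos.trans_le hL.le
  have hterm : ∀ z : E, ‖z‖ ≤ R → u T z ≤ u T 0 + k * R := by
    intro z hz
    have h1 := (abs_le.1 (hk z 0)).2
    rw [sub_zero] at h1
    have : k * ‖z‖ ≤ k * R := by gcongr
    linarith
  rcases le_or_gt T (t + 1) with h | h
  · have e1 := hu.le_add_quadratic hL ht htT le_rfl x x
    simp only [sub_self, norm_zero, ne_eq, OfNat.ofNat_ne_zero, not_false_eq_true, zero_pow,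
      mul_zero, zero_div, add_zero] at e1
    have e2 : 2 * A * (T - t) ≤ 2 * A * 1 := by gcongr; linarith
    have e3 : 0 ≤ 4 * A * R ^ 2 := by positivity
    linarith [hterm x hx]
  · have e1 := hu.le_add_quadratic hL ht (lt_add_one t) h.le x xb
    rw [add_sub_cancel_left, div_one] at e1
    have e2 := hu.le_add_integral hL (by linarith) h le_rfl xb 0 (g := fun _ => 0)
      continuous_const (fun r _ => by simpa using hxb r)
    simp only [smul_zero, add_zero, intervalIntegral.integral_zero] at e2
    have e3 : A * ‖xb - x‖ ^ 2 ≤ A * (R + R) ^ 2 := by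
      have := (norm_sub_le xb x).trans (add_le_add hxbR hx)
      gcongr
    linarith [hterm xb hxbR]

/-- The local Lipschitz bound, with a constant that does not depend on the horizon. -/
theorem HJSolution.sub_le (hL : QuadraticLagrangian L a A) (hu : HJSolution L f T u A)
    {c k R : ℝ} (hc : ∀ x, -c ≤ u T x) (hk : ∀ x y, |u T x - u T y| ≤ k * ‖x - y‖)
    (hk0 : 0 ≤ k) {xb : E}
    (hxb : ∀ t, L xb 0 + f t xb ≤ 0) (hxbR : ‖xb‖ ≤ R) {t : ℝ} (ht : 0 ≤ t) (htT : t < T) {x h : E}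
    (hx : ‖x‖ ≤ R) (hxh : ‖x + h‖ ≤ R) :
    u t (x + h) - u t x ≤ (translationConst A (2 * R) / a *
      (u T 0 + k * R + 2 * A + 4 * A * R ^ 2 + c) + translationConst A (2 * R) + k) * ‖h‖ := by
  have ha := hL.pos
  have hA : 0 < A := hL.pos.trans_le hL.le
  have hR : 0 ≤ R := (norm_nonneg x).trans hx
  set M := u T 0 + k * R + 2 * A + 4 * A * R ^ 2 with hM
  have hup : u t x ≤ M := hu.upper_bound hL hk hk0 hxb hxbR ht htT hx
  set B := translationConst A (2 * R) with hB
  have hBpos : 0 < B := by rw [hB, translationConst]; positivity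
  have hh : ‖h‖ ≤ 2 * R := by
    have := norm_sub_le (x + h) x
    rw [add_sub_cancel_left] at this
    linarith
  -- At time `t + 1` the two paths have merged. If the horizon comes first, the remaining
  -- displacement is charged to the Lipschitz constant of the terminal cost.
  set S := min T (t + 1) with hS
  have hST : S ≤ T := min_le_left _ _
  have hSt : S ≤ t + 1 := min_le_right _ _
  have htS : t < S := lt_min htT (by linarith)
  have hθ : ∀ y, u S (y + (1 - (S - t)) • h) - u S y ≤ k * ‖h‖ := by
    intro y
    rcases min_choice T (t + 1) with h' | h'
    · rw [hS, h']
      refine (le_abs_self _).trans ((hk _ _).trans ?_)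
      rw [add_sub_cancel_left, norm_smul, Real.norm_of_nonneg (by rw [hS, h'] at hSt; linarith)]
      have : (1 - (T - t)) * ‖h‖ ≤ ‖h‖ := mul_le_of_le_one_left (norm_nonneg _) (by linarith)
      gcongr
    · have : 1 - (S - t) = 0 := by rw [hS, h']; ring
      rw [this, zero_smul, add_zero, sub_self]
      positivity
  refine le_of_forall_pos_le_add fun ε hε => ?_
  -- With `t₀ = t - 1` the denominators stay in `[1, 2]`, and the lower bound on `u` gives
  -- coercivity.
  set Λ := u t x + a * (‖x‖ ^ 2 / (t - (t - 1))) + 1 with hΛ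
  have hcoer : ∀ s ∈ Icc t S, ∀ y, u s y + a * (‖y‖ ^ 2 / (s - (t - 1))) ≤ Λ →
      ‖y‖ ≤ √(2 * (Λ + c) / a) := by
    intro s hs y hy
    have e1 : -c ≤ u s y := hu.lower_bound hL hc ⟨ht.trans hs.1, hs.2.trans hST⟩ y
    have e2 : a * (‖y‖ ^ 2 / 2) ≤ a * (‖y‖ ^ 2 / (s - (t - 1))) := by
      have h1 : s - (t - 1) ≤ 2 := by linarith [hs.2]
      have h2 : 0 < s - (t - 1) := by linarith [hs.1]
      gcongr
    rw [← abs_of_nonneg (norm_nonneg y)]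
    refine Real.abs_le_sqrt ?_
    rw [le_div_iff₀ ha]
    linarith
  obtain ⟨y, -, hy⟩ := hu.exists_endpoint hL (D := 2 * R) (Λ := Λ) (t₀ := t - 1) (x := x) (h := h)
    (ρ := √(2 * (Λ + c) / a)) ht (by linarith) htS hST (by linarith) hh (by linarith) hcoer hε
  rw [← hB] at hy
  set b := B / a with hb
  have hbpos : 0 < b := by positivity
  have hlow : -c ≤ u S y := hu.lower_bound hL hc ⟨by linarith, hST⟩ y
  have e1 : b * ‖h‖ * u t x ≤ b * ‖h‖ * M := by gcongr
  have e2 : b * ‖h‖ * (-c) ≤ b * ‖h‖ * u S y := by gcongr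
  have e3 : B * ‖h‖ * (S - t) ≤ B * ‖h‖ * 1 := by gcongr; linarith
  linarith [hθ y]

end Bounds

/-! ### From the mean field game to the Hamilton-Jacobi equation -/

section Reduction

theorem QuadraticLagrangian.mono {E : Type*} [NormedAddCommGroup E] [InnerProductSpace ℝ E]
    {L : E → E → ℝ} {a A A' : ℝ} (hL : QuadraticLagrangian L a A) (h : A ≤ A') :
    QuadraticLagrangian L a A' where
  pos := hL.pos
  le := hL.le.trans h
  contDiff := hL.contDiff
  even := hL.even
  convex := hL.convex
  growth := hL.growth
  upper x v := (hL.upper x v).trans (by gcongr)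
  lipschitz_left x y v := (hL.lipschitz_left x y v).trans (by gcongr)
  lipschitz_right x v h' := (hL.lipschitz_right x v h').trans (by gcongr)

variable {E : Type*} [NormedAddCommGroup E] [MeasurableSpace E]
variable {L : E → E → ℝ} {F : E → P1 E → ℝ}

/-- Values outside `K` exceed the minimum over `K`, so a minimizer over `K` is global. -/
theorem CommonMinimizer.exists_forall_le {K : Set E}
    (h₁ : CommonMinimizer L F K) (h₂ : Confining L F K) (m₀ : P1 E) :
    ∃ xb ∈ K, ∀ m y, L xb 0 + F xb m ≤ L y 0 + F y m := by
  obtain ⟨xb, hxb⟩ := h₁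
  obtain ⟨-, δ, hδ, h⟩ := h₂
  have hmem : ∀ m, xb ∈ K ∧ IsMinOn (fun y => L y 0 + F y m) K xb := mem_iInter.1 hxb
  refine ⟨xb, (hmem m₀).1, fun m y => ?_⟩
  by_cases hy : y ∈ K
  · exact (hmem m).2 hy
  · obtain ⟨z, hz, -, hz2⟩ := h m
    have h3 : L xb 0 + F xb m ≤ L z 0 + F z m := (hmem m).2 hz
    linarith [hz2 y hy]

theorem CouplingLipschitz.continuousOn (hF : CouplingLipschitz F) {m : ℝ → P1 E} {T : ℝ}
    (hm : ∀ s ∈ Icc 0 T, Tendsto (fun t => d1 (m t) (m s)) (𝓝[Icc 0 T] s) (𝓝 0)) (x : E) :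
    ContinuousOn (fun t => F x (m t)) (Icc 0 T) := by
  obtain ⟨C, hC⟩ := hF
  intro s hs
  rw [ContinuousWithinAt, tendsto_iff_norm_sub_tendsto_zero]
  have h0 : Tendsto (fun t => C * d1 (m t) (m s)) (𝓝[Icc 0 T] s) (𝓝 0) := by
    simpa using (hm s hs).const_mul C
  exact squeeze_zero (fun t => norm_nonneg _) (fun t => hC x (m t) (m s)) h0

variable [InnerProductSpace ℝ E]

theorem CouplingRegular.exists_bound (hF : CouplingRegular F) :
    ∃ C, (∀ m x, |F x m| ≤ C) ∧ ∀ m x y, |F x m - F y m| ≤ C * ‖x - y‖ := by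
  obtain ⟨hd, -, C, hC⟩ := hF
  refine ⟨C, fun m x => by simpa using hC m 0 (by norm_num) x, fun m x y => ?_⟩
  exact convex_univ.norm_image_sub_le_of_norm_fderiv_le (𝕜 := ℝ) (f := fun x => F x m)
    (fun z _ => (hd m).differentiable (by norm_num) z)
    (fun z _ => by simpa using hC m 1 (by norm_num) z) (mem_univ y) (mem_univ x)

variable [FiniteDimensional ℝ E] [CompleteSpace E] [BorelSpace E]

/-- After subtraction of the cost of resting at a common minimizer, the first component of a
solution of the mean field game system solves a Hamilton-Jacobi equation whose data are bounded
independently of the solution. -/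
theorem IsMFGSolution.exists_hjSolution {uf : E → ℝ} {m₀ : Measure E} {T a A C : ℝ}
    {u : ℝ → E → ℝ} {m : ℝ → P1 E} (hu : IsMFGSolution L F uf m₀ T u m) (hT : 0 < T)
    (hL : QuadraticLagrangian L a A) (hF : CouplingLipschitz F)
    (hFb : ∀ m x, |F x m| ≤ C) (hFl : ∀ m x y, |F x m - F y m| ≤ C * ‖x - y‖) {xb : E}
    (hxb : ∀ m y, L xb 0 + F xb m ≤ L y 0 + F y m) (hA : 2 * C + |L xb 0| ≤ A) :
    ∃ (f : ℝ → E → ℝ) (b : ℝ → ℝ), HJSolution L f T (fun t x => u t x - b t) A ∧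
      (∀ t, L xb 0 + f t xb ≤ 0) ∧ b T = 0 := by
  -- Values of `m` outside `[0,T]` are arbitrary; projecting time makes the running cost continuous
  -- on the whole line.
  set μ : ℝ → P1 E := fun t => m (projIcc 0 T hT.le t) with hμ
  have hμm : ∀ t ∈ Icc 0 T, μ t = m t := fun t ht => by
    simp only [hμ, projIcc_of_mem hT.le ht]
  have hcont : ∀ x, Continuous fun t => F x (μ t) := fun x =>
    (hF.continuousOn hu.m_continuous x).comp_continuous
      (continuous_subtype_val.comp continuous_projIcc) fun t => (projIcc 0 T hT.le t).2
  set l : ℝ → ℝ := fun t => L xb 0 + F xb (μ t) with hl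
  have hlc : Continuous l := continuous_const.add (hcont xb)
  -- Integrating from `T` leaves the terminal values unchanged.
  set b : ℝ → ℝ := fun t => -∫ r in T..t, l r with hb
  have hbd : ContDiff ℝ 1 b := (contDiff_integral_right hlc T).neg
  have hb' : ∀ t, HasDerivAt b (-l t) t := fun t => (hasDerivAt_integral_right hlc T t).neg
  have hC : 0 ≤ C := (abs_nonneg _).trans (hFb (m 0) xb)
  have hCA : C ≤ A := by linarith [abs_nonneg (L xb 0)]
  refine ⟨fun t x => F x (μ t) - l t, b, ⟨fun x => (hcont x).sub hlc, fun t x y => ?_,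
    fun t x => ?_, fun t x => ?_, fun r => ?_, ?_, ?_⟩, fun t => ?_, by simp [hb]⟩
  · rw [sub_sub_sub_cancel_right]
    exact (hFl _ x y).trans (by gcongr)
  · have h1 := abs_le.1 (hFb (μ t) x)
    have h2 := abs_le.1 (hFb (μ t) xb)
    have h3 := abs_le.1 (le_refl |L xb 0|)
    simp only [hl]
    rw [abs_le]
    constructor <;> linarith [h1.1, h1.2, h2.1, h2.2, h3.1, h3.2]
  · simp only [hl]
    linarith [hxb (μ t) x]
  · obtain ⟨k, hk⟩ := hu.u_lipschitz r
    obtain ⟨k', hk'⟩ := hbd.contDiffOn.exists_lipschitzOnWith (by norm_num) (convex_Icc 0 T)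
      isCompact_Icc
    have h2 : LipschitzOnWith (k' * 1) (fun z : ℝ × E => b z.1)
        (Icc 0 T ×ˢ Metric.closedBall 0 r) :=
      hk'.comp LipschitzWith.prod_fst.lipschitzOnWith fun z hz => hz.1
    exact ⟨_, hk.sub h2⟩
  · have h1 := SubTest.sub_time (hu.hamilton_jacobi.subTest (f := fun t x => F x (m t)) hL) hbd hb'
    intro t ht x φ hφ hmax v
    have := h1 t ht x φ hφ hmax v
    simpa only [hμm t (Ioo_subset_Icc_self ht)] using this
  · have h1 := SuperTest.sub_time (hu.hamilton_jacobi.superTest (f := fun t x => F x (m t)) hL)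
      hbd hb'
    intro t ht x φ hφ hmin ε hε
    obtain ⟨v, hv⟩ := h1 t ht x φ hφ hmin ε hε
    exact ⟨v, by simpa only [hμm t (Ioo_subset_Icc_self ht)] using hv⟩
  · simp only [hl]
    linarith

/-- Local Lipschitz estimates for the mean field game system, uniform in the horizon. -/
theorem exists_lipschitz_bound {K : Set E} {uf : E → ℝ} (m₀ : Measure E)
    (hL : IsStrictTonelli L) (hrev : IsReversible L) (hF1 : CouplingRegular F)
    (hF2 : CouplingLipschitz F) (hF4 : Confining L F K) (hF5 : CommonMinimizer L F K)
    (hU : TerminalCost uf) {R : ℝ} (hK : K ⊆ Metric.closedBall 0 R) :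
    ∃ C : ℝ, 0 < C ∧ ∀ T : ℝ, 1 < T → ∀ (u : ℝ → E → ℝ) (m : ℝ → P1 E),
      IsMFGSolution L F uf m₀ T u m → ∀ t ∈ Icc 0 T, ∀ x h : E,
        x ∈ Metric.closedBall 0 R → x + h ∈ Metric.closedBall 0 R →
          |u t (x + h) - u t x| ≤ C * ‖h‖ := by
  rcases isEmpty_or_nonempty (P1 E) with hemp | ⟨⟨m₁⟩⟩
  · exact ⟨1, one_pos, fun T _ u m => (hemp.false (m 0)).elim⟩
  obtain ⟨a, A₀, hL₀⟩ := hL.quadraticLagrangian hrev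
  obtain ⟨C, hFb, hFl⟩ := hF1.exists_bound
  obtain ⟨xb, hxbK, hxb⟩ := hF5.exists_forall_le hF4 m₁
  obtain ⟨-, ⟨k, hk⟩, c, hc0, hc⟩ := hU
  set A := max A₀ (2 * C + |L xb 0|)
  have hLA : QuadraticLagrangian L a A := hL₀.mono (le_max_left _ _)
  have hxbR : ‖xb‖ ≤ R := mem_closedBall_zero_iff.1 (hK hxbK)
  set C₁ := translationConst A (2 * R) / a * (uf 0 + k * R + 2 * A + 4 * A * R ^ 2 + c) +
    translationConst A (2 * R) + k
  have hkd : ∀ x y, |uf x - uf y| ≤ k * ‖x - y‖ := fun x y => by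
    simpa [Real.dist_eq, dist_eq_norm] using hk.dist_le_mul x y
  have hkC : k ≤ |C₁| + k + 1 := by linarith [abs_nonneg C₁]
  refine ⟨|C₁| + k + 1, by positivity, fun T hT u m hu t ht x h hx hxh => ?_⟩
  rcases ht.2.eq_or_lt with rfl | htT
  · rw [hu.terminal, hu.terminal]
    have := hkd (x + h) x
    rw [add_sub_cancel_left] at this
    exact this.trans (by gcongr)
  obtain ⟨f, b, hw, hf, hb⟩ := hu.exists_hjSolution (by linarith) hLA hF2 hFb hFl hxb
    (le_max_right _ _)
  have hone : ∀ x h : E, ‖x‖ ≤ R → ‖x + h‖ ≤ R →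
      u t (x + h) - u t x ≤ (|C₁| + k + 1) * ‖h‖ := by
    intro x h hx hxh
    have h1 := hw.sub_le hLA (c := c) (k := k) (R := R)
      (fun x => by simpa only [hu.terminal, hb, sub_zero] using hc x)
      (fun x y => by simpa only [hu.terminal, hb, sub_zero] using hkd x y)
      k.2 hf hxbR ht.1 htT hx hxh
    simp only [hu.terminal, hb, sub_zero, sub_sub_sub_cancel_right] at h1
    refine h1.trans ?_
    have : C₁ ≤ |C₁| + k + 1 := by
      have h2 : (0 : ℝ) ≤ k := k.2
      linarith [le_abs_self C₁]
    gcongr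
  rw [mem_closedBall_zero_iff] at hx hxh
  have h1 := hone x h hx hxh
  -- Exchanging the two endpoints turns the one-sided estimate into the absolute one.
  have h2 := hone (x + h) (-h) hxh (by simpa using hx)
  rw [norm_neg, add_neg_cancel_right] at h2
  rw [abs_le]
  constructor <;> linarith

end Reduction

end MeanField

theorem proposition4p8 {n : ℕ}
    (L : EuclideanSpace ℝ (Fin n) → EuclideanSpace ℝ (Fin n) → ℝ)
    (F : EuclideanSpace ℝ (Fin n) → MeanField.P1 (EuclideanSpace ℝ (Fin n)) → ℝ)
    (K₀ : Set (EuclideanSpace ℝ (Fin n))) (uf : EuclideanSpace ℝ (Fin n) → ℝ)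
    (m₀ : Measure (EuclideanSpace ℝ (Fin n)))
    (hL : MeanField.IsStrictTonelli L) (hrev : MeanField.IsReversible L)
    (hF1 : MeanField.CouplingRegular F) (hF2 : MeanField.CouplingLipschitz F)
    (hF3 : MeanField.CouplingMonotone F) (hF4 : MeanField.Confining L F K₀)
    (hF5 : MeanField.CommonMinimizer L F K₀)
    (hU : MeanField.TerminalCost uf) (hM : MeanField.InitialMeasure m₀ K₀)
    (R₀ : ℝ) (hR₀ : 0 < R₀) (hK₀ : K₀ ⊆ Metric.closedBall 0 R₀)
    (R : ℝ) (hR : R₀ ≤ R) :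
    ∃ C : ℝ, 0 < C ∧ ∀ T : ℝ, 1 < T →
      ∀ (u : ℝ → EuclideanSpace ℝ (Fin n) → ℝ) (m : ℝ → MeanField.P1 (EuclideanSpace ℝ (Fin n))),
        MeanField.IsMFGSolution L F uf m₀ T u m →
        ∀ t ∈ Icc 0 T, ∀ x h : EuclideanSpace ℝ (Fin n),
          x ∈ Metric.closedBall 0 R → x + h ∈ Metric.closedBall 0 R →
          |u t (x + h) - u t x| ≤ C * ‖h‖ := by
  exact MeanField.exists_lipschitz_bound m₀ hL hrev hF1 hF2 hF4 hF5 hU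
    (hK₀.trans (Metric.closedBall_subset_closedBall hR))
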